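/- Setting. Let $n\ge 1$, $\sigma\ge 0$. For $x\in\mathbb{R}^n$ write $\tilde x=(x,1)\in\mathbb{R}^{n+1}$. The unknown decision rule is $f(x)=\beta^\top\tilde x$ with $\beta\in\mathbb{R}^{n+1}$, $\|\beta\|\le 1$. Cases $x_1,x_2,\dots$ with $\|x_t\|\le 1$ arrive one at a time; $x_t$ may depend arbitrarily (measurably) on everything that happened before. If case $t$ goes to court, $y_t=f(x_t)+\eta_t$ is observed, at one unit of cost, where $\eta_t\sim\mathcal N(0,\sigma^2)$ is independent of $x_t$ and of everything that happened before. Let $D_{t-1}$ be the list of the observations $(x_i,y_i)$ of the cases $i<t$ that went to court. For a dataset $D$ with data matrix $X$ (rows $\tilde x_i^\top$) and outcome vector $Y$, let $\mathcal L(D)(x)=\hat\beta_D^\top\tilde x$, where $\hat\beta_D$ is any minimizer of $\|Y-Xb\|^2$ over $\|b\|\le 1$. Let $X^\top X=U\Lambda U^\top$ be an eigendecomposition with orthonormal eigenvectors $u_i$ and eigenvalues $\lambda_i$, let $\bar U$ consist of the eigenvectors with $\lambda_i\ge 1$ and $\bar\Lambda$ be the diagonal matrix of these $\lambda_i$. For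 a case $x$ put $\bar q=X\bar U\bar\Lambda^{-1}\bar U^\top\tilde x$ and $\bar u=(u_i^\top\tilde x)_{i:\lambda_i<1}$. Algorithm (parameters $\alpha_1,\alpha_2>0$). When $x_t$ arrives, compute $\bar q,\bar u$ from $D=D_{t-1}$ and $x=x_t$. If $\|\bar q\|\le\alpha_1$ and $\|\bar u\|\le\alpha_2$, the case settles with outcome $\mathcal L(D_{t-1})(x_t)$; otherwise it is compelled to court. The court decision of case $t$ is $\mathcal L(D_{t-1}\cup\{(x_t,y_t)\})(x_t)$; for a settled case this is the decision that the court would have made. Theorem. For every $\sigma\ge 0$ there are $C>0$ and $k\in\mathbb N$ such that for all $n\ge1$, $\varepsilon>0$, $\delta\in(0,1)$ and every horizon $T\ge 1$ there are parameters $\alpha_1,\alpha_2>0$ (depending only on $\sigma,n,\varepsilon,\delta,T$) such that, for every $\beta$ with $\|\beta\|\le1$, every choice of the minimizers $\hat\beta_D$ and every process of cases and noise as above, with probability at least $1-\delta$ all of the following hold: 1. for every $t\geq 1$ at which the algorithm settles, $|\mathcal L(D_{t-1})(x_t)-f(x_t)|\le\varepsilon$; 2. for every $t\le T$ at which the algorithm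 settles, $|\mathcal L(D_{t-1})(x_t)-\mathcal L(D_{t-1}\cup\{(x_t,y_t)\})(x_t)|\le\varepsilon$; 3. the total number of cases ever compelled to court is at most $C\,\dfrac{n^3}{\varepsilon^4}\,\log^k\!\Big(3+\dfrac{nT}{\varepsilon\delta}\Big)$, that is, $\widetilde O(n^3/\varepsilon^4)$. -/

import Mathlib

open MeasureTheory ProbabilityTheory
open scoped NNReal ENNReal Matrix

namespace CourtLearning

noncomputable section

/-- A feature vector `x ∈ ℝⁿ` with a constant coordinate `1` appended. -/
def augment {n : ℕ} (x : EuclideanSpace ℝ (Fin n)) : EuclideanSpace ℝ (Fin (n + 1)) :=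
  WithLp.toLp 2 (Fin.snoc (α := fun _ => ℝ) x.ofLp 1)

/-- The decision rule with parameter `β ∈ ℝⁿ⁺¹`, whose last coordinate is the offset:
`x ↦ β₁ x₁ + ⋯ + βₙ xₙ + βₙ₊₁`. -/
def linearRule {n : ℕ} (β : EuclideanSpace ℝ (Fin (n + 1))) (x : EuclideanSpace ℝ (Fin n)) : ℝ :=
  β.ofLp ⬝ᵥ (augment x).ofLp

/-- The observations `(x, y)` of the cases brought to court so far, oldest first. -/
abbrev Dataset (n : ℕ) : Type := List (EuclideanSpace ℝ (Fin n) × ℝ)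

/-- The data matrix `X`: one row per observation, the last column constantly `1`. -/
def dataMatrix {n : ℕ} (D : Dataset n) : Matrix (Fin D.length) (Fin (n + 1)) ℝ :=
  Matrix.of fun i => (augment (D.get i).1).ofLp

/-- The vector `Y` of the observed outcomes. -/
def outcomes {n : ℕ} (D : Dataset n) : Fin D.length → ℝ :=
  fun i => (D.get i).2

theorem gram_isHermitian {n : ℕ} (D : Dataset n) :
    ((dataMatrix D)ᵀ * dataMatrix D).IsHermitian := by
  simpa using Matrix.isHermitian_conjTranspose_mul_self (dataMatrix D)

/-- The eigenvalues `λ` of `XᵀX = U Λ Uᵀ`. -/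
def eigval {n : ℕ} (D : Dataset n) (i : Fin (n + 1)) : ℝ :=
  (gram_isHermitian D).eigenvalues i

/-- The matrix `U` of an eigendecomposition `XᵀX = U Λ Uᵀ`; its columns are orthonormal
eigenvectors. -/
def eigvecMatrix {n : ℕ} (D : Dataset n) : Matrix (Fin (n + 1)) (Fin (n + 1)) ℝ :=
  (gram_isHermitian D).eigenvectorUnitary

/-- The matrix `Ū` of the eigenvectors whose eigenvalue is at least `1`. -/
def largeEigvecMatrix {n : ℕ} (D : Dataset n) :
    Matrix (Fin (n + 1)) {i : Fin (n + 1) // 1 ≤ eigval D i} ℝ :=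
  (eigvecMatrix D).submatrix id Subtype.val

/-- The matrix of the eigenvectors whose eigenvalue is less than `1`. -/
def smallEigvecMatrix {n : ℕ} (D : Dataset n) :
    Matrix (Fin (n + 1)) {i : Fin (n + 1) // eigval D i < 1} ℝ :=
  (eigvecMatrix D).submatrix id Subtype.val

/-- `q̄ = X Ū Λ̄⁻¹ Ūᵀ x`, with its Euclidean norm. -/
def qBar {n : ℕ} (D : Dataset n) (x : EuclideanSpace ℝ (Fin n)) :
    EuclideanSpace ℝ (Fin D.length) :=
  WithLp.toLp 2 ((dataMatrix D * largeEigvecMatrix D *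
    Matrix.diagonal (fun i : {i : Fin (n + 1) // 1 ≤ eigval D i} => (eigval D i.1)⁻¹) *
      (largeEigvecMatrix D)ᵀ) *ᵥ (augment x).ofLp)

/-- `ū`: the coordinates of `x` along the eigenvectors whose eigenvalue is less than `1`. -/
def uBar {n : ℕ} (D : Dataset n) (x : EuclideanSpace ℝ (Fin n)) :
    EuclideanSpace ℝ {i : Fin (n + 1) // eigval D i < 1} :=
  WithLp.toLp 2 ((smallEigvecMatrix D)ᵀ *ᵥ (augment x).ofLp)

/-- The test of the algorithm: with data `D`, the case `x` is settled; when it fails, the case is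
compelled to court. -/
def Settles {n : ℕ} (α₁ α₂ : ℝ) (D : Dataset n) (x : EuclideanSpace ℝ (Fin n)) : Prop :=
  ‖qBar D x‖ ≤ α₁ ∧ ‖uBar D x‖ ≤ α₂

/-- `b` minimizes `‖Y - X b‖²` over the unit ball of `ℝⁿ⁺¹`. -/
def IsConstrainedLeastSquares {n : ℕ} (D : Dataset n)
    (b : EuclideanSpace ℝ (Fin (n + 1))) : Prop :=
  ‖b‖ ≤ 1 ∧ ∀ b' : EuclideanSpace ℝ (Fin (n + 1)), ‖b'‖ ≤ 1 →
    ‖WithLp.toLp 2 (outcomes D - dataMatrix D *ᵥ b.ofLp)‖ ^ 2 ≤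
      ‖WithLp.toLp 2 (outcomes D - dataMatrix D *ᵥ b'.ofLp)‖ ^ 2

open Classical in
/-- The dataset available when case number `t` (counted from `0`) arrives, if the cases are
`x 0, x 1, …` and `y t` is the outcome that court proceedings for case `t` uncover: the outcome is
recorded exactly when the case is compelled to court. -/
def dataBefore {n : ℕ} (α₁ α₂ : ℝ) (x : ℕ → EuclideanSpace ℝ (Fin n)) (y : ℕ → ℝ) :
    ℕ → Dataset n
  | 0 => []
  | t + 1 =>
    if Settles α₁ α₂ (dataBefore α₁ α₂ x y t) (x t) then dataBefore α₁ α₂ x y t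
    else dataBefore α₁ α₂ x y t ++ [(x t, y t)]

open Classical in
/-- The cost of the first `N` cases: one unit for each of them that is compelled to court. -/
def courtCost {n : ℕ} (α₁ α₂ : ℝ) (x : ℕ → EuclideanSpace ℝ (Fin n)) (y : ℕ → ℝ) (N : ℕ) : ℕ :=
  ∑ t ∈ Finset.range N, if Settles α₁ α₂ (dataBefore α₁ α₂ x y t) (x t) then 0 else 1

/-- The cases arrive online in the unit ball. The sigma-algebra `ℱ t` is what is known when case `t`
has arrived; it may contain the earlier noise and any other randomness, so that `x t` may depend on
everything that happened before. The noise of case `t` is `N(0, σ²)` and independent of `ℱ t`. -/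
structure IsCaseProcess {n : ℕ} {Ω : Type*} {mΩ : MeasurableSpace Ω} (μ : Measure Ω) (σ : ℝ≥0)
    (ℱ : Filtration ℕ mΩ) (x : ℕ → Ω → EuclideanSpace ℝ (Fin n)) (η : ℕ → Ω → ℝ) : Prop where
  case_measurable : ∀ t, Measurable[ℱ t] (x t)
  case_norm_le : ∀ t ω, ‖x t ω‖ ≤ 1
  noise_measurable : ∀ t, Measurable[ℱ (t + 1)] (η t)
  noise_law : ∀ t, μ.map (η t) = gaussianReal 0 (σ ^ 2)
  noise_indep : ∀ t, Indep (MeasurableSpace.comap (η t) inferInstance) (ℱ t) μ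

end

end CourtLearning

namespace CourtLearning

noncomputable section

/-! ### Spectral quadratic forms -/

/-! Write `v` for the difference of two candidate parameters and split the augmented case along the
eigenvectors of `XᵀX`. Cauchy–Schwarz on each half of the spectrum gives `|⟨v, x̃⟩| ≤ ‖q̄‖ ‖Xv‖ +
‖ū‖ ‖v‖` (`abs_linearRule_le_qBar_uBar`). On a settled case both norms are small, so it remains to
control the energy `‖Xv‖²` and the number of court cases.

Accuracy: by convexity the constrained minimizer satisfies `‖X(β̂ - β)‖² ≤ ⟨noise, X(β̂ - β)⟩`
(`energy_le_cross`). The right side is bounded by the sums over court cases of noise times one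
coordinate of the case. The test looks only at the cases, never at the outcomes, so these sums are
predictable transforms of Gaussian noise, and Ville's inequality bounds them at all times at once by
about `√m`, where `m` bounds the number of court cases (`exists_event_noise`).

Stability: adding the optimality inequalities before and after the new observation bounds the energy
of the change by a multiple of the change in prediction at that case (`energy_le_of_append`). The
estimate is therefore self-bounding. It involves the individual outcome, hence the individual noise,
which explains the horizon `T`.

Cost: each compelled case multiplies `det(XᵀX + 1)` by at least `1 + min(α₁, α₂)²/2`, while the
determinant of `m` cases is at most `(1 + 2m)^(n+1)`. So `m` is of order `n/α²` up to logarithms, on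
every sample path (`courtCost_le`). Accuracy requires `α² √n √m ≲ ε²`, that is `α ≈ ε²/n`, which
gives `m ≈ n³/ε⁴`. -/

theorem dotProduct_eq_inner {ι : Type*} [Fintype ι] (x y : EuclideanSpace ℝ ι) : x.ofLp ⬝ᵥ y.ofLp = inner ℝ x y := by
  rw [EuclideanSpace.inner_eq_star_dotProduct, star_trivial, dotProduct_comm]

section Spectral

variable {ι : Type*} [Fintype ι] [DecidableEq ι]

/-- The quadratic form of `g(A)` for a Hermitian matrix `A`. -/
def specForm {A : Matrix ι ι ℝ} (hA : A.IsHermitian) (g : ℝ → ℝ) (x : EuclideanSpace ℝ ι) : ℝ :=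
  ∑ i, g (hA.eigenvalues i) * (inner ℝ (hA.eigenvectorBasis i) x) ^ 2

theorem aeval_mulVec_eigenvectorBasis {A : Matrix ι ι ℝ} (hA : A.IsHermitian)
    (p : Polynomial ℝ) (i : ι) :
    Polynomial.aeval A p *ᵥ (hA.eigenvectorBasis i).ofLp =
      p.eval (hA.eigenvalues i) • (hA.eigenvectorBasis i).ofLp := by
  induction p using Polynomial.induction_on' with
  | add p q hp hq => rw [map_add, Matrix.add_mulVec, hp, hq, Polynomial.eval_add, add_smul]
  | monomial k a =>
    have h : ∀ k : ℕ, A ^ k *ᵥ (hA.eigenvectorBasis i).ofLp =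
        hA.eigenvalues i ^ k • (hA.eigenvectorBasis i).ofLp := by
      intro k
      induction k with
      | zero => simp
      | succ k ih =>
        rw [pow_succ, ← Matrix.mulVec_mulVec, hA.mulVec_eigenvectorBasis, Matrix.mulVec_smul, ih,
          smul_smul, pow_succ']
    rw [Polynomial.aeval_monomial, ← Algebra.smul_def, Matrix.smul_mulVec, h,
      Polynomial.eval_monomial, smul_smul]

theorem ofLp_eq_sum_inner_smul {A : Matrix ι ι ℝ} (hA : A.IsHermitian)
    (x : EuclideanSpace ℝ ι) :
    x.ofLp = ∑ i, inner ℝ (hA.eigenvectorBasis i) x • (hA.eigenvectorBasis i).ofLp := by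
  conv_lhs => rw [← hA.eigenvectorBasis.sum_repr' x]
  simp

theorem dotProduct_eq_sum_inner {A : Matrix ι ι ℝ} (hA : A.IsHermitian)
    (x y : EuclideanSpace ℝ ι) :
    x.ofLp ⬝ᵥ y.ofLp =
      ∑ i, inner ℝ (hA.eigenvectorBasis i) x * inner ℝ (hA.eigenvectorBasis i) y := by
  rw [dotProduct_eq_inner, ← hA.eigenvectorBasis.sum_inner_mul_inner x y]
  exact Finset.sum_congr rfl fun i _ => by rw [real_inner_comm]

theorem dotProduct_aeval_mulVec {A : Matrix ι ι ℝ} (hA : A.IsHermitian) (p : Polynomial ℝ)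
    (x : EuclideanSpace ℝ ι) :
    x.ofLp ⬝ᵥ (Polynomial.aeval A p *ᵥ x.ofLp) = specForm hA (fun l => p.eval l) x := by
  conv_lhs => enter [2]; rw [ofLp_eq_sum_inner_smul hA x]
  rw [Matrix.mulVec_sum, dotProduct_sum]
  refine Finset.sum_congr rfl fun i _ => ?_
  rw [Matrix.mulVec_smul, aeval_mulVec_eigenvectorBasis, dotProduct_smul, dotProduct_smul,
    dotProduct_eq_inner, real_inner_comm, smul_eq_mul, smul_eq_mul]
  ring

theorem dotProduct_mulVec_self {A : Matrix ι ι ℝ} (hA : A.IsHermitian)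
    (x : EuclideanSpace ℝ ι) :
    x.ofLp ⬝ᵥ (A *ᵥ x.ofLp) = specForm hA (fun l => l) x := by
  have h := dotProduct_aeval_mulVec hA Polynomial.X x
  rw [Polynomial.aeval_X] at h
  simpa using h

theorem specForm_one {A : Matrix ι ι ℝ} (hA : A.IsHermitian) (x : EuclideanSpace ℝ ι) :
    specForm hA (fun _ => 1) x = ‖x‖ ^ 2 := by
  rw [← real_inner_self_eq_norm_sq, ← dotProduct_eq_inner, dotProduct_eq_sum_inner hA]
  simp [specForm, sq]

/-- Splitting the spectrum into eigenvalues at least `1` and less than `1`. -/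
theorem abs_dotProduct_le_of_spectrum {A : Matrix ι ι ℝ} (hA : A.IsHermitian)
    (h0 : ∀ i, 0 ≤ hA.eigenvalues i) (x v : EuclideanSpace ℝ ι) :
    |x.ofLp ⬝ᵥ v.ofLp| ≤
      √(specForm hA (fun l => if 1 ≤ l then l⁻¹ else 0) x) * √(v.ofLp ⬝ᵥ (A *ᵥ v.ofLp)) +
      √(specForm hA (fun l => if l < 1 then 1 else 0) x) * ‖v‖ := by
  rw [dotProduct_mulVec_self hA, ← Real.sqrt_sq (norm_nonneg v), ← specForm_one hA,
    dotProduct_eq_sum_inner hA]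
  -- On eigenvalues at least `1`, multiply and divide by `√λ`, so that `v` enters through `vᵀAv`; on
  -- the others use the plain product.
  have hs : ∀ i, inner ℝ (hA.eigenvectorBasis i) x * inner ℝ (hA.eigenvectorBasis i) v =
      (√(if 1 ≤ hA.eigenvalues i then (hA.eigenvalues i)⁻¹ else 0) *
          inner ℝ (hA.eigenvectorBasis i) x) *
        (√(hA.eigenvalues i) * inner ℝ (hA.eigenvectorBasis i) v) +
      ((if hA.eigenvalues i < 1 then 1 else 0) * inner ℝ (hA.eigenvectorBasis i) x) *
        inner ℝ (hA.eigenvectorBasis i) v := by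
    intro i
    by_cases h : 1 ≤ hA.eigenvalues i
    · rw [if_pos h, if_neg (not_lt.2 h), Real.sqrt_inv]
      have : √(hA.eigenvalues i) ≠ 0 := (Real.sqrt_pos.2 (by linarith)).ne'
      field_simp
      ring
    · rw [if_neg h, if_pos (not_le.1 h), Real.sqrt_zero]
      ring
  rw [Finset.sum_congr rfl fun i _ => hs i, Finset.sum_add_distrib]
  have cs : ∀ f g : ι → ℝ, |∑ i, f i * g i| ≤ √(∑ i, f i ^ 2) * √(∑ i, g i ^ 2) := by
    intro f g
    rw [← Real.sqrt_mul (Finset.sum_nonneg fun i _ => sq_nonneg _)]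
    exact Real.abs_le_sqrt (Finset.sum_mul_sq_le_sq_mul_sq _ f g)
  refine (abs_add_le _ _).trans (add_le_add ((cs _ _).trans_eq ?_) ((cs _ _).trans_eq ?_))
  · congr 2
    · refine Finset.sum_congr rfl fun i _ => ?_
      rw [mul_pow, Real.sq_sqrt]
      split_ifs
      · exact inv_nonneg.2 (h0 i)
      · exact le_rfl
    · exact Finset.sum_congr rfl fun i _ => by rw [mul_pow, Real.sq_sqrt (h0 i)]
  · congr 2
    · refine Finset.sum_congr rfl fun i _ => ?_
      dsimp only
      split_ifs <;> ring
    · exact Finset.sum_congr rfl fun i _ => by ring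

theorem det_add_one {A : Matrix ι ι ℝ} (hA : A.IsHermitian) :
    (A + 1).det = ∏ i, (hA.eigenvalues i + 1) := by
  -- Up to sign, `det(A + 1)` is the characteristic polynomial at `-1`.
  have h := congrArg (Polynomial.eval (-1)) hA.charpoly_eq
  rw [Matrix.eval_charpoly, Polynomial.eval_prod] at h
  have e : Matrix.scalar ι (-1 : ℝ) - A = -(A + 1) := by
    rw [map_neg, map_one]; abel
  rw [e, Matrix.det_neg] at h
  have h2 : ∏ i, Polynomial.eval (-1) (Polynomial.X - Polynomial.C (hA.eigenvalues i)) =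
      (-1) ^ Fintype.card ι * ∏ i, (hA.eigenvalues i + 1) := by
    rw [← Finset.card_univ, ← Finset.prod_const, ← Finset.prod_mul_distrib]
    exact Finset.prod_congr rfl fun i _ => by simp; ring
  have h3 : (-1 : ℝ) ^ Fintype.card ι * (A + 1).det =
      (-1) ^ Fintype.card ι * ∏ i, (hA.eigenvalues i + 1) := by rw [← h2]; simpa using h
  exact mul_left_cancel₀ (pow_ne_zero _ (by norm_num)) h3

/-- This is the matrix determinant lemma; the vector `w` in the proof is `(A + 1)⁻¹x` expanded in
the eigenbasis. -/
theorem det_add_one_add_vecMulVec {A : Matrix ι ι ℝ} (hA : A.IsHermitian)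
    (h0 : ∀ i, 0 ≤ hA.eigenvalues i) (x : EuclideanSpace ℝ ι) :
    (A + Matrix.vecMulVec x.ofLp x.ofLp + 1).det =
      (A + 1).det * (1 + specForm hA (fun l => (l + 1)⁻¹) x) := by
  have hdet : (A + 1).det ≠ 0 := by
    rw [det_add_one hA]
    exact Finset.prod_ne_zero_iff.2 fun i _ => by linarith [h0 i]
  have hu : IsUnit (A + 1).det := isUnit_iff_ne_zero.2 hdet
  set w : ι → ℝ := ∑ i, ((hA.eigenvalues i + 1)⁻¹ * inner ℝ (hA.eigenvectorBasis i) x) •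
    (hA.eigenvectorBasis i).ofLp with hw
  have hAw : (A + 1) *ᵥ w = x.ofLp := by
    rw [ofLp_eq_sum_inner_smul hA x, hw, Matrix.mulVec_sum]
    refine Finset.sum_congr rfl fun i _ => ?_
    have : hA.eigenvalues i + 1 ≠ 0 := by linarith [h0 i]
    rw [Matrix.mulVec_smul, Matrix.add_mulVec, hA.mulVec_eigenvectorBasis, Matrix.one_mulVec,
      smul_add, smul_smul, ← add_smul]
    congr 1
    field_simp
  have hw' : (A + 1)⁻¹ *ᵥ x.ofLp = w := by
    rw [← hAw, Matrix.mulVec_mulVec, Matrix.nonsing_inv_mul _ hu, Matrix.one_mulVec]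
  have h := Matrix.det_add_replicateCol_mul_replicateRow (ι := Unit) hu x.ofLp x.ofLp
  have e : A + Matrix.vecMulVec x.ofLp x.ofLp + 1 =
      (A + 1) + Matrix.replicateCol Unit x.ofLp * Matrix.replicateRow Unit x.ofLp := by
    rw [Matrix.vecMulVec_eq Unit]; abel
  rw [e, h]
  congr 1
  rw [Matrix.det_unique]
  have : (Matrix.replicateRow Unit x.ofLp * (A + 1)⁻¹ * Matrix.replicateCol Unit x.ofLp) default
      default = x.ofLp ⬝ᵥ ((A + 1)⁻¹ *ᵥ x.ofLp) := by
    rw [Matrix.mul_assoc]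
    rfl
  rw [Matrix.add_apply, this, hw', hw, dotProduct_sum, Matrix.one_apply_eq]
  congr 1
  refine Finset.sum_congr rfl fun i _ => ?_
  rw [dotProduct_smul, dotProduct_eq_inner, real_inner_comm, smul_eq_mul]
  ring

/-- A pointwise limit of continuous functions is a pointwise limit of polynomials. -/
theorem exists_polynomial_tendsto {g : ℝ → ℝ} (f : ℕ → ℝ → ℝ) (hf : ∀ k, Continuous (f k))
    (hg : ∀ t, Filter.Tendsto (fun k => f k t) Filter.atTop (nhds (g t))) :
    ∃ p : ℕ → Polynomial ℝ,
      ∀ t, Filter.Tendsto (fun k => (p k).eval t) Filter.atTop (nhds (g t)) := by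
  -- Weierstrass on the growing intervals `[-k, k]` with error `1/(k+1)`; every fixed point
  -- eventually lies inside.
  have h : ∀ k : ℕ, ∃ p : Polynomial ℝ, ∀ t ∈ Set.Icc (-k : ℝ) k,
      |p.eval t - f k t| < 1 / ((k : ℝ) + 1) := fun k =>
    exists_polynomial_near_of_continuousOn _ _ (f k) (hf k).continuousOn _ (by positivity)
  choose p hp using h
  refine ⟨p, fun t => ?_⟩
  have h1 : Filter.Tendsto (fun k => (p k).eval t - f k t) Filter.atTop (nhds 0) := by
    refine squeeze_zero_norm' ?_ tendsto_one_div_add_atTop_nhds_zero_nat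
    filter_upwards [Filter.eventually_ge_atTop ⌈|t|⌉₊] with k hk
    have : |t| ≤ k := (Nat.le_ceil _).trans (by exact_mod_cast hk)
    exact (hp k t (abs_le.1 this)).le
  simpa using h1.add (hg t)

/-- Quadratic forms of `g(A)` are measurable in `A` and the vector, `g` being a pointwise limit of
polynomials. -/
theorem measurable_specForm {Ω : Type*} {m : MeasurableSpace Ω} {A : Ω → Matrix ι ι ℝ}
    (hA : ∀ ω, (A ω).IsHermitian) {x : Ω → EuclideanSpace ℝ ι}
    (hAm : ∀ i j, Measurable fun ω => A ω i j) (hx : ∀ i, Measurable fun ω => (x ω).ofLp i)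
    {g : ℝ → ℝ} (p : ℕ → Polynomial ℝ)
    (hp : ∀ t, Filter.Tendsto (fun k => (p k).eval t) Filter.atTop (nhds (g t))) :
    Measurable fun ω => specForm (hA ω) g (x ω) := by
  have hpow : ∀ (k : ℕ) (i j : ι), Measurable fun ω => (A ω ^ k) i j := by
    intro k
    induction k with
    | zero => intro i j; simp
    | succ k ih =>
      intro i j
      simp only [pow_succ, Matrix.mul_apply]
      exact Finset.measurable_sum _ fun l _ => (ih i l).mul (hAm l j)
  have haeval : ∀ (q : Polynomial ℝ) (i j : ι),
      Measurable fun ω => (Polynomial.aeval (A ω) q) i j := by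
    intro q i j
    simp only [Polynomial.aeval_eq_sum_range, Matrix.sum_apply, Matrix.smul_apply, smul_eq_mul]
    exact Finset.measurable_sum _ fun l _ => (hpow l i j).const_mul _
  refine measurable_of_tendsto_metrizable
    (f := fun k ω => (x ω).ofLp ⬝ᵥ (Polynomial.aeval (A ω) (p k) *ᵥ (x ω).ofLp)) (fun k => ?_) ?_
  · simp only [dotProduct, Matrix.mulVec]
    exact Finset.measurable_sum _ fun i _ => (hx i).mul
      (Finset.measurable_sum _ fun j _ => (haeval _ i j).mul (hx j))
  · refine tendsto_pi_nhds.2 fun ω => ?_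
    simp only [dotProduct_aeval_mulVec (hA ω), specForm]
    exact tendsto_finsetSum _ fun i _ => (hp _).mul_const _

end Spectral

/-! ### Datasets -/

section Data

variable {n : ℕ}

theorem augment_castSucc (x : EuclideanSpace ℝ (Fin n)) (i : Fin n) :
    (augment x).ofLp i.castSucc = x.ofLp i := by
  simp [augment]

theorem augment_last (x : EuclideanSpace ℝ (Fin n)) :
    (augment x).ofLp (Fin.last n) = 1 := by
  simp [augment]

theorem norm_augment_sq (x : EuclideanSpace ℝ (Fin n)) : ‖augment x‖ ^ 2 = ‖x‖ ^ 2 + 1 := by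
  rw [EuclideanSpace.real_norm_sq_eq, EuclideanSpace.real_norm_sq_eq, Fin.sum_univ_castSucc]
  simp [augment_castSucc, augment_last]

theorem norm_augment_sq_le {x : EuclideanSpace ℝ (Fin n)} (hx : ‖x‖ ≤ 1) :
    ‖augment x‖ ^ 2 ≤ 2 := by
  rw [norm_augment_sq]
  nlinarith [norm_nonneg x]

theorem abs_augment_le {x : EuclideanSpace ℝ (Fin n)} (hx : ‖x‖ ≤ 1) (j : Fin (n + 1)) :
    |(augment x).ofLp j| ≤ 1 := by
  refine Fin.lastCases ?_ (fun i => ?_) j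
  · rw [augment_last, abs_one]
  · rw [augment_castSucc]
    exact (PiLp.norm_apply_le x i).trans hx

theorem linearRule_eq_inner (β : EuclideanSpace ℝ (Fin (n + 1))) (x : EuclideanSpace ℝ (Fin n)) :
    linearRule β x = inner ℝ β (augment x) :=
  dotProduct_eq_inner _ _

theorem abs_linearRule_le (β : EuclideanSpace ℝ (Fin (n + 1))) {x : EuclideanSpace ℝ (Fin n)}
    (hx : ‖x‖ ≤ 1) : |linearRule β x| ≤ ‖β‖ * (3 / 2) := by
  rw [linearRule_eq_inner]
  refine (abs_real_inner_le_norm _ _).trans (mul_le_mul_of_nonneg_left ?_ (norm_nonneg _))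
  -- `3/2` is a rational bound for `√2`.
  nlinarith [norm_augment_sq_le hx, norm_nonneg (augment x)]

theorem linearRule_sub (b c : EuclideanSpace ℝ (Fin (n + 1))) (x : EuclideanSpace ℝ (Fin n)) :
    linearRule (b - c) x = linearRule b x - linearRule c x := by
  simp [linearRule_eq_inner, inner_sub_left]

theorem sum_fin_get {α : Type*} (D : List α) (f : α → ℝ) :
    ∑ k : Fin D.length, f (D.get k) = (D.map f).sum :=
  Fin.sum_univ_fun_getElem D f

/-- The Gram matrix `XᵀX` of the data. -/
def gram (D : Dataset n) : Matrix (Fin (n + 1)) (Fin (n + 1)) ℝ :=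
  (dataMatrix D)ᵀ * dataMatrix D

theorem isHermitian_gram (D : Dataset n) : (gram D).IsHermitian := gram_isHermitian D

theorem gram_apply (D : Dataset n) (i j : Fin (n + 1)) :
    gram D i j = (D.map fun p => (augment p.1).ofLp i * (augment p.1).ofLp j).sum := by
  rw [← sum_fin_get]
  simp [gram, Matrix.mul_apply, dataMatrix]

theorem gram_nil : gram ([] : Dataset n) = 0 := by
  ext i j
  simp [gram_apply]

theorem gram_append (D : Dataset n) (x : EuclideanSpace ℝ (Fin n)) (y : ℝ) :
    gram (D ++ [(x, y)]) =
      gram D + Matrix.vecMulVec (augment x).ofLp (augment x).ofLp := by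
  ext i j
  simp [gram_apply, Matrix.vecMulVec_apply]

theorem eigenvalues_gram_nonneg (D : Dataset n) (i : Fin (n + 1)) :
    0 ≤ (isHermitian_gram D).eigenvalues i := by
  have h : (gram D).PosSemidef := by
    simpa [gram] using Matrix.posSemidef_conjTranspose_mul_self (dataMatrix D)
  exact h.eigenvalues_nonneg i

/-- The squared length `‖X v‖²` of the predictions of `v` on the data. -/
def energy (D : Dataset n) (v : EuclideanSpace ℝ (Fin (n + 1))) : ℝ :=
  (D.map fun p => linearRule v p.1 ^ 2).sum

theorem energy_nonneg (D : Dataset n) (v : EuclideanSpace ℝ (Fin (n + 1))) : 0 ≤ energy D v :=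
  List.sum_nonneg fun a ha => by
    obtain ⟨p, -, rfl⟩ := List.mem_map.1 ha
    exact sq_nonneg _

theorem dataMatrix_mulVec (D : Dataset n) (v : EuclideanSpace ℝ (Fin (n + 1)))
    (k : Fin D.length) : (dataMatrix D *ᵥ v.ofLp) k = linearRule v (D.get k).1 := by
  rw [linearRule, dotProduct_comm]
  rfl

theorem norm_dataMatrix_mulVec_sq (D : Dataset n) (v : EuclideanSpace ℝ (Fin (n + 1))) :
    ‖WithLp.toLp 2 (dataMatrix D *ᵥ v.ofLp)‖ ^ 2 = energy D v := by
  rw [EuclideanSpace.real_norm_sq_eq, energy, ← sum_fin_get]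
  exact Finset.sum_congr rfl fun k _ => by rw [← dataMatrix_mulVec]

theorem dotProduct_gram_mulVec (D : Dataset n) (v : EuclideanSpace ℝ (Fin (n + 1))) :
    v.ofLp ⬝ᵥ (gram D *ᵥ v.ofLp) = energy D v := by
  rw [← norm_dataMatrix_mulVec_sq, gram, ← Matrix.mulVec_mulVec, Matrix.dotProduct_mulVec,
    Matrix.vecMul_transpose, EuclideanSpace.real_norm_sq_eq, dotProduct]
  exact Finset.sum_congr rfl fun k _ => (sq _).symm

theorem sum_subtype_eq_sum_ite {ι : Type*} [Fintype ι] (P : ι → Prop) [DecidablePred P] (f : ι → ℝ) :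
    ∑ i : {i // P i}, f i = ∑ i, if P i then f i else 0 := by
  rw [← Finset.sum_filter]
  exact (Finset.sum_subtype _ (by simp) f).symm

theorem transpose_eigvec_mulVec (D : Dataset n) (x : EuclideanSpace ℝ (Fin (n + 1)))
    (i : Fin (n + 1)) :
    ((eigvecMatrix D)ᵀ *ᵥ x.ofLp) i = inner ℝ ((isHermitian_gram D).eigenvectorBasis i) x := by
  rw [← dotProduct_eq_inner]
  rfl

theorem norm_uBar_sq (D : Dataset n) (x : EuclideanSpace ℝ (Fin n)) :
    ‖uBar D x‖ ^ 2 =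
      specForm (isHermitian_gram D) (fun l => if l < 1 then 1 else 0) (augment x) := by
  rw [EuclideanSpace.real_norm_sq_eq, specForm]
  have : ∀ i : {i : Fin (n + 1) // eigval D i < 1}, (uBar D x).ofLp i =
      inner ℝ ((isHermitian_gram D).eigenvectorBasis i.1) (augment x) := fun i =>
    transpose_eigvec_mulVec D (augment x) i.1
  simp only [this]
  rw [sum_subtype_eq_sum_ite (fun i => eigval D i < 1)
    (fun i => inner ℝ ((isHermitian_gram D).eigenvectorBasis i) (augment x) ^ 2)]
  refine Finset.sum_congr rfl fun i _ => ?_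
  rw [ite_mul, one_mul, zero_mul]
  rfl

/-- Here `q̄ = Xw`, where `w` has eigencoordinates `λ⁻¹⟨uᵢ, x̃⟩` on the large eigenvalues and `0`
elsewhere. Since `‖Xw‖² = wᵀXᵀXw`, each weight is `λ · λ⁻² = λ⁻¹`. -/
theorem norm_qBar_sq (D : Dataset n) (x : EuclideanSpace ℝ (Fin n)) :
    ‖qBar D x‖ ^ 2 =
      specForm (isHermitian_gram D) (fun l => if 1 ≤ l then l⁻¹ else 0) (augment x) := by
  set hA := isHermitian_gram D
  set w : EuclideanSpace ℝ (Fin (n + 1)) := ∑ i,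
    ((if 1 ≤ hA.eigenvalues i then (hA.eigenvalues i)⁻¹ else 0) *
      inner ℝ (hA.eigenvectorBasis i) (augment x)) • hA.eigenvectorBasis i with hw
  have hq : qBar D x = WithLp.toLp 2 (dataMatrix D *ᵥ w.ofLp) := by
    rw [qBar, Matrix.mul_assoc, Matrix.mul_assoc, ← Matrix.mulVec_mulVec]
    congr 2
    ext j
    rw [← Matrix.mulVec_mulVec, ← Matrix.mulVec_mulVec, hw, Matrix.mulVec, dotProduct]
    have h1 : ∀ i : {i : Fin (n + 1) // 1 ≤ eigval D i},
        largeEigvecMatrix D j i * ((Matrix.diagonal fun i : {i : Fin (n + 1) // 1 ≤ eigval D i} =>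
          (eigval D i.1)⁻¹) *ᵥ ((largeEigvecMatrix D)ᵀ *ᵥ (augment x).ofLp)) i =
        (fun i : Fin (n + 1) => (hA.eigenvectorBasis i).ofLp j *
          ((hA.eigenvalues i)⁻¹ * inner ℝ (hA.eigenvectorBasis i) (augment x))) i.1 := by
      intro i
      rw [Matrix.mulVec_diagonal]
      have := transpose_eigvec_mulVec D (augment x) i.1
      exact congrArg₂ _ rfl (congrArg₂ _ rfl this)
    rw [Finset.sum_congr rfl fun i _ => h1 i]
    refine (sum_subtype_eq_sum_ite (fun i => 1 ≤ eigval D i) (fun i => (hA.eigenvectorBasis i).ofLp j *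
      ((hA.eigenvalues i)⁻¹ * inner ℝ (hA.eigenvectorBasis i) (augment x)))).trans ?_
    simp only [WithLp.ofLp_sum, WithLp.ofLp_smul, Finset.sum_apply, Pi.smul_apply, smul_eq_mul]
    refine Finset.sum_congr rfl fun i _ => ?_
    have : eigval D i = hA.eigenvalues i := rfl
    rw [this]
    split_ifs <;> ring
  rw [hq, norm_dataMatrix_mulVec_sq, ← dotProduct_gram_mulVec, dotProduct_mulVec_self hA]
  refine Finset.sum_congr rfl fun i _ => ?_
  have hi : inner ℝ (hA.eigenvectorBasis i) w =
      (if 1 ≤ hA.eigenvalues i then (hA.eigenvalues i)⁻¹ else 0) *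
      inner ℝ (hA.eigenvectorBasis i) (augment x) := by
    rw [hw]
    exact hA.eigenvectorBasis.orthonormal.inner_right_fintype _ i
  rw [hi]
  dsimp only
  split_ifs with h
  · have : hA.eigenvalues i ≠ 0 := by linarith
    field_simp
  · simp

/-- Both guarantees for settled cases rest on this bound, with `v` the difference of the estimate
from `β` or from the court's estimate. -/
theorem abs_linearRule_le_qBar_uBar (D : Dataset n) (x : EuclideanSpace ℝ (Fin n))
    (v : EuclideanSpace ℝ (Fin (n + 1))) :
    |linearRule v x| ≤ ‖qBar D x‖ * √(energy D v) + ‖uBar D x‖ * ‖v‖ := by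
  have h := abs_dotProduct_le_of_spectrum (isHermitian_gram D) (eigenvalues_gram_nonneg D)
    (augment x) v
  rwa [← norm_uBar_sq, ← norm_qBar_sq, dotProduct_gram_mulVec, Real.sqrt_sq (norm_nonneg _),
    Real.sqrt_sq (norm_nonneg _), dotProduct_comm] at h

theorem norm_uBar_le (D : Dataset n) (x : EuclideanSpace ℝ (Fin n)) :
    ‖uBar D x‖ ≤ ‖augment x‖ := by
  refine (pow_le_pow_iff_left₀ (norm_nonneg _) (norm_nonneg _) two_ne_zero).1 ?_
  rw [norm_uBar_sq, ← specForm_one (isHermitian_gram D)]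
  refine Finset.sum_le_sum fun i _ => mul_le_mul_of_nonneg_right ?_ (sq_nonneg _)
  dsimp only
  split_ifs <;> norm_num

/-! ### The determinant potential -/

theorem one_le_det_gram_add_one (D : Dataset n) : 1 ≤ (gram D + 1).det := by
  rw [det_add_one (isHermitian_gram D)]
  calc (1 : ℝ) = ∏ _i : Fin (n + 1), 1 := by simp
    _ ≤ _ := Finset.prod_le_prod (fun _ _ => zero_le_one) fun i _ => by
      linarith [eigenvalues_gram_nonneg D i]

/-- The growth factor has weights `1/(λ+1)`, which is at least `1/(2λ)` for `λ ≥ 1` and at least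
`1/2` for `λ < 1`: half the weights of `‖q̄‖²` and `‖ū‖²`. -/
theorem det_gram_append_ge (D : Dataset n) (x : EuclideanSpace ℝ (Fin n)) (y : ℝ) :
    (gram D + 1).det * (1 + (‖qBar D x‖ ^ 2 + ‖uBar D x‖ ^ 2) / 2) ≤
      (gram (D ++ [(x, y)]) + 1).det := by
  rw [gram_append, det_add_one_add_vecMulVec (isHermitian_gram D) (eigenvalues_gram_nonneg D)]
  refine mul_le_mul_of_nonneg_left ?_ (zero_le_one.trans (one_le_det_gram_add_one D))
  rw [norm_uBar_sq, norm_qBar_sq, specForm, specForm, specForm, ← Finset.sum_add_distrib,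
    Finset.sum_div]
  refine add_le_add_right (Finset.sum_le_sum fun i _ => ?_) 1
  rw [← add_mul, mul_div_right_comm]
  refine mul_le_mul_of_nonneg_right ?_ (sq_nonneg _)
  have h0 := eigenvalues_gram_nonneg D i
  generalize (isHermitian_gram D).eigenvalues i = l at *
  by_cases h : 1 ≤ l
  · rw [if_pos h, if_neg (not_lt.2 h), add_zero, ← one_div, div_div, ← one_div]
    exact one_div_le_one_div_of_le (by linarith) (by linarith)
  · rw [if_neg h, if_pos (not_le.1 h), zero_add, ← one_div]
    exact one_div_le_one_div_of_le (by linarith) (by linarith)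

/-- Each eigenvalue is at most the trace, which is the sum of the squared augmented norms, each at
most `2`. -/
theorem det_gram_add_one_le (D : Dataset n) (hD : ∀ p ∈ D, ‖p.1‖ ≤ 1) :
    (gram D + 1).det ≤ (1 + 2 * D.length) ^ (n + 1) := by
  have htr : ∑ i, (isHermitian_gram D).eigenvalues i ≤ 2 * D.length := by
    have h := (isHermitian_gram D).trace_eq_sum_eigenvalues
    have h2 : (gram D).trace = (D.map fun p => ‖augment p.1‖ ^ 2).sum := by
      rw [← sum_fin_get, Matrix.trace]
      simp only [Matrix.diag_apply, gram_apply, ← sum_fin_get, EuclideanSpace.real_norm_sq_eq]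
      rw [Finset.sum_comm]
      simp only [sq]
    have h3 : (D.map fun p => ‖augment p.1‖ ^ 2).sum ≤ 2 * D.length := by
      rw [← sum_fin_get]
      refine (Finset.sum_le_card_nsmul _ _ 2 fun k _ =>
        norm_augment_sq_le (hD _ (D.get_mem k))).trans_eq ?_
      simp [mul_comm]
    rw [← h2, h] at h3
    simpa using h3
  rw [det_add_one (isHermitian_gram D)]
  have hle : ∀ i ∈ Finset.univ, (isHermitian_gram D).eigenvalues i + 1 ≤ 1 + 2 * D.length := by
    intro i hi
    have := Finset.single_le_sum (f := (isHermitian_gram D).eigenvalues)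
      (fun j _ => eigenvalues_gram_nonneg D j) hi
    linarith
  refine (Finset.prod_le_prod (fun i _ => by linarith [eigenvalues_gram_nonneg D i]) hle).trans_eq
    ?_
  simp

/-! ### Constrained least squares -/

/-- The residual sum of squares `‖Y - X b‖²`. -/
def rss (D : Dataset n) (b : EuclideanSpace ℝ (Fin (n + 1))) : ℝ :=
  (D.map fun p => (p.2 - linearRule b p.1) ^ 2).sum

/-- The inner product of the residuals of `b` with the predictions of `v`. -/
def cross (D : Dataset n) (b v : EuclideanSpace ℝ (Fin (n + 1))) : ℝ :=
  (D.map fun p => (p.2 - linearRule b p.1) * linearRule v p.1).sum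

theorem norm_residual_sq (D : Dataset n) (b : EuclideanSpace ℝ (Fin (n + 1))) :
    ‖WithLp.toLp 2 (outcomes D - dataMatrix D *ᵥ b.ofLp)‖ ^ 2 = rss D b := by
  rw [EuclideanSpace.real_norm_sq_eq, rss, ← sum_fin_get]
  refine Finset.sum_congr rfl fun k _ => ?_
  rw [← dataMatrix_mulVec]
  rfl

theorem rss_add_smul (D : Dataset n) (b v : EuclideanSpace ℝ (Fin (n + 1))) (s : ℝ) :
    rss D (b + s • v) = rss D b - 2 * s * cross D b v + s ^ 2 * energy D v := by
  simp only [rss, cross, energy]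
  induction D with
  | nil => simp
  | cons p D ih =>
    simp only [List.map_cons, List.sum_cons, ih]
    simp only [linearRule_eq_inner, inner_add_left, real_inner_smul_left]
    ring

theorem rss_append (D : Dataset n) (x : EuclideanSpace ℝ (Fin n)) (y : ℝ)
    (b : EuclideanSpace ℝ (Fin (n + 1))) :
    rss (D ++ [(x, y)]) b = rss D b + (y - linearRule b x) ^ 2 := by
  simp [rss]

theorem energy_append (D : Dataset n) (x : EuclideanSpace ℝ (Fin n)) (y : ℝ)
    (b : EuclideanSpace ℝ (Fin (n + 1))) :
    energy (D ++ [(x, y)]) b = energy D b + linearRule b x ^ 2 := by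
  simp [energy]

theorem energy_sub_comm (D : Dataset n) (b c : EuclideanSpace ℝ (Fin (n + 1))) :
    energy D (b - c) = energy D (c - b) := by
  simp only [energy, linearRule_sub]
  congr 2
  ext p
  ring

/-- The ball is convex, so the derivative of the residual sum of squares at the minimizer towards
`b'` is nonnegative; the exact quadratic expansion then leaves the energy as a gap. -/
theorem IsConstrainedLeastSquares.rss_add_energy_le {D : Dataset n}
    {b b' : EuclideanSpace ℝ (Fin (n + 1))} (hb : IsConstrainedLeastSquares D b)
    (hb' : ‖b'‖ ≤ 1) : rss D b + energy D (b' - b) ≤ rss D b' := by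
  have hs : ∀ s : ℝ, 0 < s → s ≤ 1 → 2 * cross D b (b' - b) ≤ s * energy D (b' - b) := by
    intro s hs0 hs1
    have hn : ‖b + s • (b' - b)‖ ≤ 1 := by
      have : b + s • (b' - b) = (1 - s) • b + s • b' := by module
      rw [this]
      refine (norm_add_le _ _).trans ?_
      rw [norm_smul, norm_smul, Real.norm_of_nonneg hs0.le, Real.norm_of_nonneg (by linarith)]
      nlinarith [hb.1]
    have h := hb.2 _ hn
    rw [norm_residual_sq, norm_residual_sq, rss_add_smul] at h
    have : 0 ≤ s * (s * energy D (b' - b) - 2 * cross D b (b' - b)) := by linarith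
    linarith [nonneg_of_mul_nonneg_right this hs0]
  have hc : cross D b (b' - b) ≤ 0 := by
    by_contra! hpos
    have hE := energy_nonneg D (b' - b)
    -- With `E` the energy and `c > 0` the cross term, `s ≤ c/(E + 1)` makes `sE ≤ c`, contradicting
    -- `2c ≤ sE`.
    have h1 := hs (min 1 (cross D b (b' - b) / (energy D (b' - b) + 1))) (by positivity)
      (min_le_left _ _)
    have h2 := mul_le_mul_of_nonneg_right
      (min_le_right 1 (cross D b (b' - b) / (energy D (b' - b) + 1))) hE
    have h3 : cross D b (b' - b) / (energy D (b' - b) + 1) * energy D (b' - b) ≤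
        cross D b (b' - b) := by
      rw [div_mul_eq_mul_div, div_le_iff₀ (by linarith)]
      nlinarith
    linarith
  have h := rss_add_smul D b (b' - b) 1
  rw [one_smul, add_sub_cancel] at h
  linarith

/-- The prediction error on the data is controlled by its correlation with the noise. -/
theorem IsConstrainedLeastSquares.energy_le_cross {D : Dataset n}
    {b β : EuclideanSpace ℝ (Fin (n + 1))} (hb : IsConstrainedLeastSquares D b)
    (hβ : ‖β‖ ≤ 1) : energy D (b - β) ≤ cross D β (b - β) := by
  have h1 := hb.rss_add_energy_le hβ
  have h2 := rss_add_smul D β (b - β) 1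
  rw [one_smul, add_sub_cancel] at h2
  rw [energy_sub_comm] at h1
  linarith

theorem cross_eq_sum (D : Dataset n) (b v : EuclideanSpace ℝ (Fin (n + 1))) :
    cross D b v = ∑ j, v.ofLp j *
      (D.map fun p => (p.2 - linearRule b p.1) * (augment p.1).ofLp j).sum := by
  simp only [cross, ← sum_fin_get, Finset.mul_sum]
  rw [Finset.sum_comm]
  refine Finset.sum_congr rfl fun k _ => ?_
  simp only [linearRule, dotProduct, Finset.mul_sum]
  exact Finset.sum_congr rfl fun j _ => by ring

/-- Cauchy–Schwarz over the coordinates costs a factor `√(n+1)`, but reduces the noise control to `n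
+ 1` scalar sums that do not depend on `v`, which itself depends on the noise. -/
theorem cross_le {D : Dataset n} {b v : EuclideanSpace ℝ (Fin (n + 1))} {B : ℝ} (hB : 0 ≤ B)
    (hD : ∀ j, |(D.map fun p => (p.2 - linearRule b p.1) * (augment p.1).ofLp j).sum| ≤ B) :
    cross D b v ≤ ‖v‖ * (√(n + 1) * B) := by
  rw [cross_eq_sum]
  refine (le_abs_self _).trans ((Real.abs_le_sqrt
    (Finset.sum_mul_sq_le_sq_mul_sq Finset.univ (fun j => v.ofLp j) _)).trans ?_)
  rw [← EuclideanSpace.real_norm_sq_eq]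
  refine Real.sqrt_le_iff.2 ⟨by positivity, ?_⟩
  rw [mul_pow, mul_pow, Real.sq_sqrt (by positivity)]
  refine mul_le_mul_of_nonneg_left ?_ (sq_nonneg _)
  refine (Finset.sum_le_card_nsmul _ _ (B ^ 2) fun j _ => sq_le_sq' ?_ ?_).trans_eq ?_
  · exact (abs_le.1 (hD j)).1
  · exact (abs_le.1 (hD j)).2
  · simp

/-- Stability of constrained least squares under one more observation. -/
theorem IsConstrainedLeastSquares.energy_le_of_append {D : Dataset n}
    {x : EuclideanSpace ℝ (Fin n)} {y : ℝ} {b b' : EuclideanSpace ℝ (Fin (n + 1))}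
    (hb : IsConstrainedLeastSquares D b) (hb' : IsConstrainedLeastSquares (D ++ [(x, y)]) b')
    (hx : ‖x‖ ≤ 1) :
    energy D (b - b') ≤ (|y| + 3 / 2) * |linearRule b x - linearRule b' x| := by
  have h1 := hb.rss_add_energy_le hb'.1
  have h2 := hb'.rss_add_energy_le hb.1
  rw [rss_append, rss_append, energy_append] at h2
  rw [energy_sub_comm] at h1
  have h3 : (2 * y - linearRule b x - linearRule b' x) * (linearRule b' x - linearRule b x) ≤
      (2 * |y| + 3) * |linearRule b x - linearRule b' x| := by
    refine (le_abs_self _).trans ?_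
    rw [abs_mul, abs_sub_comm (linearRule b' x)]
    refine mul_le_mul_of_nonneg_right ?_ (abs_nonneg _)
    have e1 := (abs_linearRule_le b hx).trans (mul_le_mul_of_nonneg_right hb.1 (by norm_num))
    have e2 := (abs_linearRule_le b' hx).trans (mul_le_mul_of_nonneg_right hb'.1 (by norm_num))
    have e3 := abs_sub (2 * y - linearRule b x) (linearRule b' x)
    have e4 := abs_sub (2 * y) (linearRule b x)
    rw [abs_mul, abs_two] at e4
    linarith
  nlinarith [sq_nonneg (linearRule (b - b') x)]

end Data

/-! ### Exponential martingales with Gaussian noise -/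

section Prob

variable {Ω : Type*} {mΩ : MeasurableSpace Ω}

/-- The compensator `v a²/2` is the logarithm of the Gaussian moment generating function at `a`. -/
theorem lintegral_exp_gaussianReal (v : ℝ≥0) (l a : ℝ) :
    ∫⁻ e, ENNReal.ofReal (Real.exp (l + (a * e - v * a ^ 2 / 2))) ∂gaussianReal 0 v =
      ENNReal.ofReal (Real.exp l) := by
  have h : ∀ e, Real.exp (l + (a * e - v * a ^ 2 / 2)) =
      Real.exp (l - v * a ^ 2 / 2) * Real.exp (a * e) := by
    intro e
    rw [← Real.exp_add]
    ring_nf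
  simp only [h]
  rw [← ofReal_integral_eq_lintegral_ofReal
    ((integrable_exp_mul_gaussianReal a).const_mul _)
    (Filter.Eventually.of_forall fun e => by positivity), integral_const_mul]
  have h2 : ∫ e, Real.exp (a * e) ∂gaussianReal 0 v = Real.exp (v * a ^ 2 / 2) := by
    have := mgf_gaussianReal (p := gaussianReal 0 v) (X := id) (μ := 0) (v := v) (by simp) a
    simpa [mgf] using this
  rw [h2, ← Real.exp_add]
  ring_nf

/-- The logarithm of the exponential martingale with predictable coefficients `a`. -/
def logMart (v : ℝ≥0) (η a : ℕ → Ω → ℝ) (N : ℕ) (ω : Ω) : ℝ :=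
  ∑ s ∈ Finset.range N, (a s ω * η s ω - v * a s ω ^ 2 / 2)

theorem measurable_logMart {v : ℝ≥0} {ℱ : Filtration ℕ mΩ} {η a : ℕ → Ω → ℝ}
    (hη : ∀ t, Measurable[ℱ (t + 1)] (η t)) (ha : ∀ t, Measurable[ℱ t] (a t)) (N : ℕ) :
    Measurable[ℱ N] (logMart v η a N) := by
  refine Finset.measurable_sum _ fun s hs => ?_
  have hs' : s + 1 ≤ N := Finset.mem_range.1 hs
  have h1 : Measurable[ℱ N] (η s) := (hη s).mono (ℱ.mono hs') le_rfl
  have h2 : Measurable[ℱ N] (a s) := (ha s).mono (ℱ.mono (by omega)) le_rfl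
  exact (h2.mul h1).sub (((h2.pow_const 2).const_mul _).div_const 2)

/-- The past sum and the next coefficient are `ℱ N`-measurable, hence jointly independent of `η N`;
integrating out that noise first removes the last factor. -/
theorem lintegral_exp_logMart {μ : Measure Ω} [IsProbabilityMeasure μ] {v : ℝ≥0}
    {ℱ : Filtration ℕ mΩ} {η a : ℕ → Ω → ℝ} (hη : ∀ t, Measurable[ℱ (t + 1)] (η t))
    (hlaw : ∀ t, μ.map (η t) = gaussianReal 0 v)
    (hind : ∀ t, Indep (MeasurableSpace.comap (η t) inferInstance) (ℱ t) μ)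
    (ha : ∀ t, Measurable[ℱ t] (a t)) (N : ℕ) :
    ∫⁻ ω, ENNReal.ofReal (Real.exp (logMart v η a N ω)) ∂μ = 1 := by
  induction N with
  | zero => simp [logMart]
  | succ N ih =>
    have hL : Measurable[ℱ N] (logMart v η a N) := measurable_logMart hη ha N
    have hZ : Measurable[ℱ N] fun ω => (logMart v η a N ω, a N ω) := hL.prodMk (ha N)
    have hZ' : Measurable fun ω => (logMart v η a N ω, a N ω) := hZ.mono (ℱ.le N) le_rfl
    have hηN : Measurable (η N) := (hη N).mono (ℱ.le _) le_rfl
    have hif : IndepFun (fun ω => (logMart v η a N ω, a N ω)) (η N) μ := by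
      rw [IndepFun_iff_Indep]
      exact indep_of_indep_of_le_left (hind N).symm hZ.comap_le
    have hmap := (indepFun_iff_map_prod_eq_prod_map_map hZ'.aemeasurable hηN.aemeasurable).1 hif
    set F : (ℝ × ℝ) × ℝ → ℝ≥0∞ := fun p =>
      ENNReal.ofReal (Real.exp (p.1.1 + (p.1.2 * p.2 - v * p.1.2 ^ 2 / 2))) with hF
    have hFm : Measurable F := by fun_prop
    have h1 : ∫⁻ ω, ENNReal.ofReal (Real.exp (logMart v η a (N + 1) ω)) ∂μ =
        ∫⁻ p, F p ∂μ.map (fun ω => ((logMart v η a N ω, a N ω), η N ω)) := by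
      rw [lintegral_map hFm (hZ'.prodMk hηN)]
      refine lintegral_congr fun ω => ?_
      rw [logMart, Finset.sum_range_succ]
      rfl
    rw [h1, hmap, hlaw N, lintegral_prod _ hFm.aemeasurable]
    simp only [hF, lintegral_exp_gaussianReal]
    rw [lintegral_map (f := fun p : ℝ × ℝ => ENNReal.ofReal (Real.exp p.1)) (by fun_prop) hZ']
    exact ih

/-- Ville's inequality for the exponential martingale. -/
theorem measure_exists_le_logMart {μ : Measure Ω} [IsProbabilityMeasure μ] {v : ℝ≥0}
    {ℱ : Filtration ℕ mΩ} {η a : ℕ → Ω → ℝ} (hη : ∀ t, Measurable[ℱ (t + 1)] (η t))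
    (hlaw : ∀ t, μ.map (η t) = gaussianReal 0 v)
    (hind : ∀ t, Indep (MeasurableSpace.comap (η t) inferInstance) (ℱ t) μ)
    (ha : ∀ t, Measurable[ℱ t] (a t)) (c : ℝ) :
    μ {ω | ∃ N, c ≤ logMart v η a N ω} ≤ ENNReal.ofReal (Real.exp (-c)) := by
  classical
  -- Coefficients switched off once level `c` is reached: the stopped process keeps its value at the
  -- first crossing, so Markov's inequality at time `N` covers all earlier times.
  set b : ℕ → Ω → ℝ := fun s ω => if ∀ k ∈ Finset.range (s + 1), logMart v η a k ω < c
    then a s ω else 0 with hb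
  have hbm : ∀ t, Measurable[ℱ t] (b t) := by
    intro t
    refine Measurable.ite ?_ (ha t) measurable_const
    have : {ω | ∀ k ∈ Finset.range (t + 1), logMart v η a k ω < c} =
        ⋂ k ∈ Finset.range (t + 1), {ω | logMart v η a k ω < c} := by ext; simp
    rw [this]
    refine Finset.measurableSet_biInter _ fun k hk => ?_
    have hk' : k ≤ t := by simpa [Nat.lt_succ_iff] using hk
    exact ((measurable_logMart hη ha k).mono (ℱ.mono hk') le_rfl) measurableSet_Iio
  have hreach : ∀ (N : ℕ) (ω : Ω), (∃ k ≤ N, c ≤ logMart v η a k ω) →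
      c ≤ logMart v η b N ω := by
    intro N ω hex
    have hex' : ∃ k, c ≤ logMart v η a k ω := hex.imp fun _ h => h.2
    obtain ⟨k, hkN, hk⟩ := hex
    have hfN : Nat.find hex' ≤ N := (Nat.find_min' hex' hk).trans hkN
    have hlt : ∀ s, s < Nat.find hex' → b s ω = a s ω := by
      intro s hs
      refine if_pos fun k hk => not_le.1 fun hle => ?_
      have := Nat.find_min' hex' hle
      have := Finset.mem_range.1 hk
      omega
    have hge : ∀ s, Nat.find hex' ≤ s → b s ω = 0 := by
      intro s hs
      refine if_neg fun hall => ?_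
      exact absurd (Nat.find_spec hex') (not_le.2 (hall _ (Finset.mem_range.2 (by omega))))
    have heq : logMart v η b N ω = logMart v η a (Nat.find hex') ω := by
      rw [logMart, logMart, ← Finset.sum_subset (Finset.range_mono hfN)]
      · refine Finset.sum_congr rfl fun s hs => ?_
        rw [hlt s (Finset.mem_range.1 hs)]
      · intro s _ hs
        rw [hge s (by simpa using hs)]
        simp
    rw [heq]
    exact Nat.find_spec hex'
  have hbound : ∀ N : ℕ, μ {ω | ∃ k ≤ N, c ≤ logMart v η a k ω} ≤
      ENNReal.ofReal (Real.exp (-c)) := by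
    intro N
    have hmeas : Measurable (logMart v η b N) :=
      (measurable_logMart hη hbm N).mono (ℱ.le N) le_rfl
    have hM := mul_meas_ge_le_lintegral (μ := μ)
      (f := fun ω => ENNReal.ofReal (Real.exp (logMart v η b N ω))) (by fun_prop)
      (ENNReal.ofReal (Real.exp c))
    rw [lintegral_exp_logMart hη hlaw hind hbm N] at hM
    have hsub : μ {ω | ∃ k ≤ N, c ≤ logMart v η a k ω} ≤
        μ {ω | ENNReal.ofReal (Real.exp c) ≤
          ENNReal.ofReal (Real.exp (logMart v η b N ω))} :=
      measure_mono fun ω hω => ENNReal.ofReal_le_ofReal (Real.exp_le_exp.2 (hreach N ω hω))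
    rw [Real.exp_neg, ENNReal.ofReal_inv_of_pos (Real.exp_pos c)]
    refine hsub.trans ?_
    rw [← one_div, ENNReal.le_div_iff_mul_le
      (Or.inl (by simpa using Real.exp_pos c)) (Or.inl ENNReal.ofReal_ne_top), mul_comm]
    exact hM
  have hU : {ω | ∃ N, c ≤ logMart v η a N ω} =
      ⋃ N, {ω | ∃ k ≤ N, c ≤ logMart v η a k ω} := by
    ext ω
    simp only [Set.mem_ofPred_eq, Set.mem_iUnion]
    exact ⟨fun ⟨N, h⟩ => ⟨N, N, le_rfl, h⟩, fun ⟨_, k, _, h⟩ => ⟨k, h⟩⟩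
  rw [hU, Monotone.measure_iUnion]
  · exact iSup_le hbound
  · exact fun M N hMN ω ⟨k, hk, h⟩ => ⟨k, hk.trans hMN, h⟩

end Prob

/-! ### Uniform control of finitely many noise transforms -/

section Good

variable {Ω : Type*} {mΩ : MeasurableSpace Ω}

theorem logMart_neg (v : ℝ≥0) (η a : ℕ → Ω → ℝ) (N : ℕ) (ω : Ω) :
    logMart v η (fun s ω => -a s ω) N ω =
      -(∑ s ∈ Finset.range N, a s ω * η s ω) - v / 2 * ∑ s ∈ Finset.range N, a s ω ^ 2 := by
  rw [logMart, Finset.mul_sum, ← Finset.sum_neg_distrib, ← Finset.sum_sub_distrib]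
  exact Finset.sum_congr rfl fun s _ => by ring

/-- Finitely many predictable transforms of the noise are simultaneously controlled, uniformly in
time. -/
theorem exists_good_event {κ : Type*} [Fintype κ] [Nonempty κ] {μ : Measure Ω}
    [IsProbabilityMeasure μ] {v : ℝ≥0} {ℱ : Filtration ℕ mΩ} {η : ℕ → Ω → ℝ}
    {a : κ → ℕ → Ω → ℝ} (hη : ∀ t, Measurable[ℱ (t + 1)] (η t))
    (hlaw : ∀ t, μ.map (η t) = gaussianReal 0 v)
    (hind : ∀ t, Indep (MeasurableSpace.comap (η t) inferInstance) (ℱ t) μ)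
    (ha : ∀ k t, Measurable[ℱ t] (a k t)) {δ : ℝ} (hδ : 0 < δ) :
    ∃ G : Set Ω, MeasurableSet G ∧ ENNReal.ofReal (1 - δ) ≤ μ G ∧ ∀ ω ∈ G, ∀ k N,
      |∑ s ∈ Finset.range N, a k s ω * η s ω| ≤
        Real.log (2 * Fintype.card κ / δ) + v / 2 * ∑ s ∈ Finset.range N, a k s ω ^ 2 := by
  -- A union bound over both signs of each transform: `2|κ|` events of probability at most `exp(-c)
  -- = δ/(2|κ|)`.
  set c := Real.log (2 * Fintype.card κ / δ) with hc
  have hcard : (0 : ℝ) < Fintype.card κ := by exact_mod_cast Fintype.card_pos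
  set a' : κ × Bool → ℕ → Ω → ℝ := fun p => bif p.2 then a p.1 else fun s ω => -a p.1 s ω with ha'
  have ha'm : ∀ p t, Measurable[ℱ t] (a' p t) := by
    rintro ⟨k, _ | _⟩ t
    · exact (ha k t).neg
    · exact ha k t
  set B : κ × Bool → Set Ω := fun p => {ω | ∃ N, c ≤ logMart v η (a' p) N ω} with hB
  have hBm : ∀ p, MeasurableSet (B p) := by
    intro p
    have : B p = ⋃ N, {ω | c ≤ logMart v η (a' p) N ω} := by ext; simp [hB]
    rw [this]
    exact MeasurableSet.iUnion fun N =>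
      ((measurable_logMart hη (ha'm p) N).mono (ℱ.le N) le_rfl) measurableSet_Ici
  have hBU : MeasurableSet (⋃ p, B p) := MeasurableSet.iUnion hBm
  refine ⟨(⋃ p, B p)ᶜ, hBU.compl, ?_, ?_⟩
  · have hle : μ (⋃ p, B p) ≤ ENNReal.ofReal δ := by
      refine (measure_iUnion_fintype_le μ B).trans ((Finset.sum_le_card_nsmul _ _
        (ENNReal.ofReal (Real.exp (-c))) fun p _ =>
          measure_exists_le_logMart hη hlaw hind (ha'm p) c).trans_eq ?_)
      rw [nsmul_eq_mul, ← ENNReal.ofReal_natCast, ← ENNReal.ofReal_mul (Nat.cast_nonneg _)]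
      congr 1
      rw [hc, Real.exp_neg, Real.exp_log (by positivity)]
      simp only [Finset.card_univ, Fintype.card_prod, Fintype.card_bool, Nat.cast_mul,
        Nat.cast_ofNat]
      field_simp
    rw [prob_compl_eq_one_sub hBU, ENNReal.ofReal_sub _ hδ.le, ENNReal.ofReal_one]
    exact tsub_le_tsub_left hle 1
  · intro ω hω k N
    have hlt : ∀ p, logMart v η (a' p) N ω < c := fun p =>
      not_le.1 fun h => hω (Set.mem_iUnion.2 ⟨p, N, h⟩)
    have h1 := hlt (k, true)
    have h2 := hlt (k, false)
    have e1 := logMart_neg v η (fun s ω => -a k s ω) N ω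
    simp only [neg_neg, neg_mul, Finset.sum_neg_distrib, neg_sq] at e1
    simp only [ha', cond_true] at h1
    simp only [ha', cond_false, logMart_neg] at h2
    have e2 : logMart v η (a k) N ω = _ := e1
    rw [abs_le]
    constructor <;> linarith

end Good

/-! ### The online process: cost, measurability and noise -/

section Online

variable {n : ℕ} {α₁ α₂ : ℝ}

theorem norm_le_of_mem_dataBefore {x : ℕ → EuclideanSpace ℝ (Fin n)} (y : ℕ → ℝ)
    (hx : ∀ t, ‖x t‖ ≤ 1) (t : ℕ) : ∀ p ∈ dataBefore α₁ α₂ x y t, ‖p.1‖ ≤ 1 := by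
  induction t with
  | zero => simp [dataBefore]
  | succ t ih =>
    intro p hp
    rw [dataBefore] at hp
    split_ifs at hp
    · exact ih p hp
    · rcases List.mem_append.1 hp with h | h
      · exact ih p h
      · rw [List.mem_singleton.1 h]
        exact hx t

/-- The indicator of case `t` being compelled to court. -/
def courtIndicator (α₁ α₂ : ℝ) (x : ℕ → EuclideanSpace ℝ (Fin n)) (y : ℕ → ℝ) (t : ℕ) : ℝ :=
  open Classical in if Settles α₁ α₂ (dataBefore α₁ α₂ x y t) (x t) then 0 else 1

theorem sum_map_dataBefore (x : ℕ → EuclideanSpace ℝ (Fin n)) (y : ℕ → ℝ)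
    (f : EuclideanSpace ℝ (Fin n) × ℝ → ℝ) (t : ℕ) :
    ((dataBefore α₁ α₂ x y t).map f).sum =
      ∑ s ∈ Finset.range t, courtIndicator α₁ α₂ x y s * f (x s, y s) := by
  induction t with
  | zero => simp [dataBefore]
  | succ t ih =>
    rw [Finset.sum_range_succ, ← ih, dataBefore, courtIndicator]
    split_ifs <;> simp

theorem courtCost_eq_sum (x : ℕ → EuclideanSpace ℝ (Fin n)) (y : ℕ → ℝ) (N : ℕ) :
    (courtCost α₁ α₂ x y N : ℝ) = ∑ s ∈ Finset.range N, courtIndicator α₁ α₂ x y s := by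
  simp [courtCost, courtIndicator]

theorem length_dataBefore (x : ℕ → EuclideanSpace ℝ (Fin n)) (y : ℕ → ℝ) (N : ℕ) :
    ((dataBefore α₁ α₂ x y N).length : ℝ) = courtCost α₁ α₂ x y N := by
  have h := sum_map_dataBefore (α₁ := α₁) (α₂ := α₂) x y (fun _ => 1) N
  rw [courtCost_eq_sum]
  simpa using h

/-- A compelled case violates one of the two thresholds, so `‖q̄‖² + ‖ū‖²` is at least `min α₁ α₂ ^
2`. -/
theorem pow_courtCost_le_det (h₁ : 0 < α₁) (h₂ : 0 < α₂) (x : ℕ → EuclideanSpace ℝ (Fin n))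
    (y : ℕ → ℝ) (N : ℕ) :
    (1 + min α₁ α₂ ^ 2 / 2) ^ courtCost α₁ α₂ x y N ≤
      (gram (dataBefore α₁ α₂ x y N) + 1).det := by
  induction N with
  | zero => simp [courtCost, dataBefore, gram_nil]
  | succ N ih =>
    have hc : courtCost α₁ α₂ x y (N + 1) = courtCost α₁ α₂ x y N +
        open Classical in if Settles α₁ α₂ (dataBefore α₁ α₂ x y N) (x N) then 0 else 1 := by
      rw [courtCost, Finset.sum_range_succ]
      rfl
    rw [hc, dataBefore]
    split_ifs with h
    · exact ih
    · rw [pow_succ]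
      refine le_trans (mul_le_mul ih ?_ (by positivity)
        (zero_le_one.trans (one_le_det_gram_add_one _))) (det_gram_append_ge _ _ _)
      have hmin : 0 < min α₁ α₂ := lt_min h₁ h₂
      have : min α₁ α₂ ^ 2 ≤ ‖qBar (dataBefore α₁ α₂ x y N) (x N)‖ ^ 2 +
          ‖uBar (dataBefore α₁ α₂ x y N) (x N)‖ ^ 2 := by
        rw [Settles, not_and_or, not_le, not_le] at h
        rcases h with h | h
        · nlinarith [pow_le_pow_left₀ hmin.le ((min_le_left α₁ α₂).trans h.le) 2,
            sq_nonneg ‖uBar (dataBefore α₁ α₂ x y N) (x N)‖]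
        · nlinarith [pow_le_pow_left₀ hmin.le ((min_le_right α₁ α₂).trans h.le) 2,
            sq_nonneg ‖qBar (dataBefore α₁ α₂ x y N) (x N)‖]
      linarith

theorem le_of_mul_log_le {m d γ : ℝ} (hm : 0 ≤ m) (hd : 1 ≤ d) (hγ : 0 < γ) (hγ1 : γ ≤ 1)
    (h : m * Real.log (1 + γ) ≤ d * Real.log (1 + 2 * m)) :
    m ≤ 4 * d / γ * Real.log (8 * d / γ) := by
  have h1 : γ / 2 ≤ Real.log (1 + γ) := by
    have := Real.one_sub_inv_le_log_of_pos (x := 1 + γ) (by linarith)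
    refine le_trans ?_ this
    have e : 1 - (1 + γ)⁻¹ = γ / (1 + γ) := by field_simp; ring
    rw [e]
    exact div_le_div_of_nonneg_left hγ.le (by linarith) (by linarith)
  -- The tangent-line bound on the logarithm, with slope `γ/(8d)` chosen so that the term linear in
  -- `m` is at most half of the left side.
  have h2 : Real.log (1 + 2 * m) ≤ (1 + 2 * m) * (γ / (8 * d)) - 1 + Real.log (8 * d / γ) := by
    have h3 := Real.log_le_sub_one_of_pos (x := (1 + 2 * m) * (γ / (8 * d))) (by positivity)
    rw [Real.log_mul (by positivity) (by positivity)] at h3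
    have h4 : Real.log (8 * d / γ) = -Real.log (γ / (8 * d)) := by
      rw [← Real.log_inv, inv_div]
    linarith
  have h5 : m * (γ / 2) ≤ d * ((1 + 2 * m) * (γ / (8 * d)) - 1 + Real.log (8 * d / γ)) :=
    (mul_le_mul_of_nonneg_left h1 hm).trans (h.trans (mul_le_mul_of_nonneg_left h2 (by linarith)))
  have h6 : d * ((1 + 2 * m) * (γ / (8 * d)) - 1 + Real.log (8 * d / γ)) =
      γ / 8 + m * γ / 4 - d + d * Real.log (8 * d / γ) := by
    field_simp
    ring
  rw [h6] at h5
  rw [div_mul_eq_mul_div, le_div_iff₀ hγ]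
  nlinarith

/-- The bound is deterministic: it holds for every outcome sequence and every `N`, so it can be used
to normalize the noise sums. -/
theorem courtCost_le (h₁ : 0 < α₁) (h₂ : 0 < α₂) {γ : ℝ} (hγ : 0 < γ) (hγ1 : γ ≤ 1)
    (hγα : γ ≤ min α₁ α₂ ^ 2 / 2) {x : ℕ → EuclideanSpace ℝ (Fin n)}
    (hx : ∀ t, ‖x t‖ ≤ 1) (y : ℕ → ℝ) (N : ℕ) :
    (courtCost α₁ α₂ x y N : ℝ) ≤ 4 * (n + 1) / γ * Real.log (8 * (n + 1) / γ) := by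
  refine le_of_mul_log_le (Nat.cast_nonneg _) (by linarith [Nat.cast_nonneg (α := ℝ) n]) hγ hγ1 ?_
  have h := (pow_courtCost_le_det h₁ h₂ x y N).trans
    (det_gram_add_one_le _ (norm_le_of_mem_dataBefore y hx N))
  rw [length_dataBefore] at h
  have h3 := Real.log_le_log (by positivity)
    ((pow_le_pow_left₀ (by positivity) (add_le_add_right hγα 1) _).trans h)
  rw [Real.log_pow, Real.log_pow] at h3
  simpa using h3

theorem tendsto_clamp (l : ℝ) :
    Filter.Tendsto (fun k : ℕ => max 0 (1 - k * max 0 (1 - l))) Filter.atTop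
      (nhds (if 1 ≤ l then 1 else 0)) := by
  split_ifs with h
  · rw [max_eq_left (by linarith : 1 - l ≤ 0)]
    simp
  · have h' : 0 < 1 - l := by linarith
    refine tendsto_const_nhds.congr' ?_
    filter_upwards [Filter.eventually_ge_atTop ⌈1 / (1 - l)⌉₊] with k hk
    have : 1 / (1 - l) ≤ k := (Nat.le_ceil _).trans (by exact_mod_cast hk)
    rw [div_le_iff₀ h'] at this
    rw [max_eq_right h'.le, max_eq_left (by linarith)]

theorem exists_polynomial_tendsto_qBar : ∃ p : ℕ → Polynomial ℝ, ∀ l,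
    Filter.Tendsto (fun k => (p k).eval l) Filter.atTop (nhds (if 1 ≤ l then l⁻¹ else 0)) := by
  refine exists_polynomial_tendsto
    (fun k l => max 0 (1 - k * max 0 (1 - l)) * (max l 1)⁻¹) (fun k => ?_) (fun l => ?_)
  · refine Continuous.mul (by fun_prop) (Continuous.inv₀ (by fun_prop) fun l => ?_)
    exact (lt_max_of_lt_right one_pos).ne'
  · convert (tendsto_clamp l).mul_const (max l 1)⁻¹ using 2
    split_ifs with h
    · rw [max_eq_left h, one_mul]
    · rw [zero_mul]

theorem exists_polynomial_tendsto_uBar : ∃ p : ℕ → Polynomial ℝ, ∀ l : ℝ,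
    Filter.Tendsto (fun k => (p k).eval l) Filter.atTop (nhds (if l < 1 then 1 else 0)) := by
  refine exists_polynomial_tendsto
    (fun k l => 1 - max 0 (1 - k * max 0 (1 - l))) (fun k => by fun_prop) (fun l => ?_)
  convert (tendsto_clamp l).const_sub 1 using 2
  by_cases h : 1 ≤ l
  · rw [if_neg (not_lt.2 h), if_pos h, sub_self]
  · rw [if_pos (not_le.1 h), if_neg h, sub_zero]

/-- No measurable choice of eigenvectors is needed: the two norms are quadratic forms of functions
of the Gram matrix, and these are limits of polynomial ones. -/
theorem measurableSet_settles {Ω : Type*} {m : MeasurableSpace Ω} {D : Ω → Dataset n}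
    {x : Ω → EuclideanSpace ℝ (Fin n)} (hD : ∀ i j, Measurable fun ω => gram (D ω) i j)
    (hx : ∀ i, Measurable fun ω => (augment (x ω)).ofLp i) :
    MeasurableSet {ω | Settles α₁ α₂ (D ω) (x ω)} := by
  obtain ⟨p, hp⟩ := exists_polynomial_tendsto_qBar
  obtain ⟨q, hq⟩ := exists_polynomial_tendsto_uBar
  have h1 : Measurable fun ω => ‖qBar (D ω) (x ω)‖ := by
    have h := (measurable_specForm (fun ω => isHermitian_gram (D ω)) hD hx p hp).sqrt
    simp only [← norm_qBar_sq, Real.sqrt_sq (norm_nonneg _)] at h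
    exact h
  have h2 : Measurable fun ω => ‖uBar (D ω) (x ω)‖ := by
    have h := (measurable_specForm (fun ω => isHermitian_gram (D ω)) hD hx q hq).sqrt
    simp only [← norm_uBar_sq, Real.sqrt_sq (norm_nonneg _)] at h
    exact h
  exact (h1 measurableSet_Iic).inter (h2 measurableSet_Iic)

variable {Ω : Type*} {mΩ : MeasurableSpace Ω} {ℱ : Filtration ℕ mΩ}
  {x : ℕ → Ω → EuclideanSpace ℝ (Fin n)}

theorem measurable_augment {m : MeasurableSpace Ω} {z : Ω → EuclideanSpace ℝ (Fin n)}
    (hz : Measurable z) (j : Fin (n + 1)) : Measurable fun ω => (augment (z ω)).ofLp j := by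
  refine Fin.lastCases ?_ (fun i => ?_) j
  · simp only [augment_last]
    exact measurable_const
  · simp only [augment_castSucc]
    fun_prop

/-- Outcomes enter neither the test nor the Gram matrix, so `y` can be arbitrary, without any
measurability. -/
theorem measurable_gram_dataBefore (hx : ∀ t, Measurable[ℱ t] (x t)) (y : ℕ → Ω → ℝ) (t : ℕ) :
    ∀ i j, Measurable[ℱ t] fun ω =>
      gram (dataBefore α₁ α₂ (fun s => x s ω) (fun s => y s ω) t) i j := by
  classical
  induction t with
  | zero =>
    intro i j
    simp only [dataBefore]
    exact measurable_const
  | succ t ih =>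
    intro i j
    refine Measurable.mono (ma := ℱ t) ?_ (ℱ.mono t.le_succ) le_rfl
    have hset := measurableSet_settles (α₁ := α₁) (α₂ := α₂) ih (measurable_augment (hx t))
    have heq : (fun ω => gram (dataBefore α₁ α₂ (fun s => x s ω) (fun s => y s ω) (t + 1)) i j) =
        fun ω => if Settles α₁ α₂ (dataBefore α₁ α₂ (fun s => x s ω) (fun s => y s ω) t) (x t ω)
          then gram (dataBefore α₁ α₂ (fun s => x s ω) (fun s => y s ω) t) i j
          else gram (dataBefore α₁ α₂ (fun s => x s ω) (fun s => y s ω) t) i j +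
            (augment (x t ω)).ofLp i * (augment (x t ω)).ofLp j := by
      funext ω
      rw [dataBefore]
      split_ifs
      · rfl
      · rw [gram_append, Matrix.add_apply, Matrix.vecMulVec_apply]
    rw [heq]
    exact Measurable.ite hset (ih i j)
      ((ih i j).add ((measurable_augment (hx t) i).mul (measurable_augment (hx t) j)))

theorem measurable_courtIndicator (hx : ∀ t, Measurable[ℱ t] (x t)) (y : ℕ → Ω → ℝ) (t : ℕ) :
    Measurable[ℱ t] fun ω => courtIndicator α₁ α₂ (fun s => x s ω) (fun s => y s ω) t := by
  have hset := measurableSet_settles (α₁ := α₁) (α₂ := α₂)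
    (measurable_gram_dataBefore (α₁ := α₁) (α₂ := α₂) hx y t) (measurable_augment (hx t))
  exact Measurable.ite hset measurable_const measurable_const

/-- With probability `1 - δ`, the noise of the court cases is controlled in every coordinate at all
times, and the noise of the first `T` cases is bounded. -/
theorem exists_event_noise {μ : Measure Ω} [IsProbabilityMeasure μ] {σ : ℝ≥0} {η : ℕ → Ω → ℝ}
    (h : IsCaseProcess μ σ ℱ x η) (y : ℕ → Ω → ℝ) (T : ℕ) {δ m : ℝ} (hδ : 0 < δ) (hm : 0 < m)
    (hcost : ∀ ω N, (courtCost α₁ α₂ (fun s => x s ω) (fun s => y s ω) N : ℝ) ≤ m) :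
    ∃ G : Set Ω, MeasurableSet G ∧ ENNReal.ofReal (1 - δ) ≤ μ G ∧ ∀ ω ∈ G,
      (∀ j N, |∑ s ∈ Finset.range N, courtIndicator α₁ α₂ (fun s => x s ω) (fun s => y s ω) s *
        (η s ω * (augment (x s ω)).ofLp j)| ≤
          √m * (Real.log (2 * (n + 1 + T) / δ) + σ ^ 2 / 2)) ∧
      ∀ t < T, |η t ω| ≤ Real.log (2 * (n + 1 + T) / δ) + σ ^ 2 / 2 := by
  -- Dividing by `√m` makes the squared coefficients sum to at most `1`, so the deviation scales as
  -- `√m`; the second family isolates the single noises `η t`, `t < T`.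
  set a : Fin (n + 1) ⊕ Fin T → ℕ → Ω → ℝ := Sum.elim
    (fun j s ω => courtIndicator α₁ α₂ (fun s => x s ω) (fun s => y s ω) s *
      (augment (x s ω)).ofLp j / √m)
    (fun t s _ => if s = t then 1 else 0) with ha
  have ham : ∀ k t, Measurable[ℱ t] (a k t) := by
    rintro (j | t') t
    · exact ((measurable_courtIndicator h.case_measurable y t).mul
        (measurable_augment (h.case_measurable t) j)).div_const _
    · exact measurable_const
  obtain ⟨G, hG, hμ, hgood⟩ := exists_good_event h.noise_measurable h.noise_law h.noise_indep ham hδ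
  have hcard : (Fintype.card (Fin (n + 1) ⊕ Fin T) : ℝ) = n + 1 + T := by simp
  rw [hcard, NNReal.coe_pow] at hgood
  have hsm : 0 < √m := Real.sqrt_pos.2 hm
  refine ⟨G, hG, hμ, fun ω hω => ⟨fun j N => ?_, fun t ht => ?_⟩⟩
  · have h1 := hgood ω hω (Sum.inl j) N
    have h2 : ∑ s ∈ Finset.range N, a (Sum.inl j) s ω ^ 2 ≤ 1 := by
      have h3 : ∀ s ∈ Finset.range N, a (Sum.inl j) s ω ^ 2 ≤
          courtIndicator α₁ α₂ (fun s => x s ω) (fun s => y s ω) s / m := by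
        intro s _
        simp only [ha, Sum.elim_inl]
        rw [div_pow, Real.sq_sqrt hm.le, mul_pow]
        refine div_le_div_of_nonneg_right ?_ hm.le
        have h4 : (augment (x s ω)).ofLp j ^ 2 ≤ 1 :=
          (sq_le_one_iff_abs_le_one _).2 (abs_augment_le (h.case_norm_le s ω) j)
        rw [courtIndicator]
        split_ifs
        · simp
        · simpa using h4
      refine (Finset.sum_le_sum h3).trans ?_
      rw [← Finset.sum_div, ← courtCost_eq_sum, div_le_one hm]
      exact hcost ω N
    have h5 : ∑ s ∈ Finset.range N, courtIndicator α₁ α₂ (fun s => x s ω) (fun s => y s ω) s *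
        (η s ω * (augment (x s ω)).ofLp j) =
        √m * ∑ s ∈ Finset.range N, a (Sum.inl j) s ω * η s ω := by
      rw [Finset.mul_sum]
      refine Finset.sum_congr rfl fun s _ => ?_
      simp only [ha, Sum.elim_inl]
      field_simp
    rw [h5, abs_mul, abs_of_pos hsm]
    refine mul_le_mul_of_nonneg_left (h1.trans ?_) hsm.le
    have : (σ : ℝ) ^ 2 / 2 * ∑ s ∈ Finset.range N, a (Sum.inl j) s ω ^ 2 ≤ σ ^ 2 / 2 * 1 :=
      mul_le_mul_of_nonneg_left h2 (by positivity)
    linarith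
  · have h1 := hgood ω hω (Sum.inr ⟨t, ht⟩) (t + 1)
    simp only [ha, Sum.elim_inr, ite_mul, one_mul, zero_mul, ite_pow, one_pow, ne_eq,
      OfNat.ofNat_ne_zero, not_false_eq_true, zero_pow, Finset.sum_ite_eq', Finset.mem_range,
      Nat.lt_add_one, if_true, mul_one] at h1
    exact h1

end Online

/-! ### Guarantees on settled cases and choice of parameters -/

section Guarantees

variable {n : ℕ} {α₁ α₂ ε : ℝ}

/-- A settled case is decided almost correctly. -/
theorem Settles.abs_sub_le {D : Dataset n} {x : EuclideanSpace ℝ (Fin n)}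
    {b β : EuclideanSpace ℝ (Fin (n + 1))} (hs : Settles α₁ α₂ D x)
    (hb : IsConstrainedLeastSquares D b) (hβ : ‖β‖ ≤ 1) (h₁ : 0 ≤ α₁) (h₂ : α₂ ≤ ε / 4)
    (hε : 0 ≤ ε) {B : ℝ} (hB : 0 ≤ B) (hα : α₁ ^ 2 * (2 * (√(n + 1) * B)) ≤ ε ^ 2 / 4)
    (hD : ∀ j, |(D.map fun p => (p.2 - linearRule β p.1) * (augment p.1).ofLp j).sum| ≤ B) :
    |linearRule b x - linearRule β x| ≤ ε := by
  have hv : ‖b - β‖ ≤ 2 := (norm_sub_le _ _).trans (by linarith [hb.1])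
  have hE : energy D (b - β) ≤ 2 * (√(n + 1) * B) :=
    (hb.energy_le_cross hβ).trans ((cross_le hB hD).trans
      (mul_le_mul_of_nonneg_right hv (by positivity)))
  have h1 : α₁ * √(energy D (b - β)) ≤ ε / 2 := by
    refine (pow_le_pow_iff_left₀ (by positivity) (by positivity) two_ne_zero).1 ?_
    rw [mul_pow, Real.sq_sqrt (energy_nonneg _ _)]
    nlinarith [mul_le_mul_of_nonneg_left hE (sq_nonneg α₁)]
  have h := abs_linearRule_le_qBar_uBar D x (b - β)
  rw [linearRule_sub] at h
  have h3 := mul_le_mul_of_nonneg_right hs.1 (Real.sqrt_nonneg (energy D (b - β)))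
  have h4 : ‖uBar D x‖ * ‖b - β‖ ≤ ε / 4 * 2 :=
    mul_le_mul (hs.2.trans h₂) hv (norm_nonneg _) (by linarith)
  linarith

/-- A settled case would have been decided similarly by the court. -/
theorem Settles.abs_sub_append_le {D : Dataset n} {x : EuclideanSpace ℝ (Fin n)} {y : ℝ}
    {b b' : EuclideanSpace ℝ (Fin (n + 1))} (hs : Settles α₁ α₂ D x)
    (hb : IsConstrainedLeastSquares D b) (hb' : IsConstrainedLeastSquares (D ++ [(x, y)]) b')
    (hx : ‖x‖ ≤ 1) (h₁ : 0 ≤ α₁) (h₂ : α₂ ≤ ε / 4) (hε : 0 ≤ ε)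
    (hα : α₁ ^ 2 * (|y| + 3 / 2) ≤ ε / 4) :
    |linearRule b x - linearRule b' x| ≤ ε := by
  -- If the change `s` exceeded `ε`, then `α₁²` times the energy would be at most `εs/4 ≤ s²/4`, so
  -- `s ≤ s/2 + ε/2 < s`.
  by_contra! hlt
  have hv : ‖b - b'‖ ≤ 2 := (norm_sub_le _ _).trans (by linarith [hb.1, hb'.1])
  have hE := hb.energy_le_of_append hb' hx
  have h := abs_linearRule_le_qBar_uBar D x (b - b')
  rw [linearRule_sub] at h
  generalize |linearRule b x - linearRule b' x| = s at *
  have h1 : α₁ * √(energy D (b - b')) ≤ s / 2 := by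
    refine (pow_le_pow_iff_left₀ (by positivity) (by linarith) two_ne_zero).1 ?_
    rw [mul_pow, Real.sq_sqrt (energy_nonneg _ _)]
    have := mul_le_mul_of_nonneg_left hE (sq_nonneg α₁)
    have := mul_le_mul_of_nonneg_right hα (by linarith : 0 ≤ s)
    nlinarith
  have h3 := mul_le_mul_of_nonneg_right hs.1 (Real.sqrt_nonneg (energy D (b - b')))
  have h4 : ‖uBar D x‖ * ‖b - b'‖ ≤ ε / 4 * 2 :=
    mul_le_mul (hs.2.trans h₂) hv (norm_nonneg _) (by linarith)
  linarith

/-- When `ε` is large, every case is settled on the empty dataset. -/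
theorem dataBefore_eq_nil (h₁ : 0 ≤ α₁) (h₂ : 2 ≤ α₂) {x : ℕ → EuclideanSpace ℝ (Fin n)}
    (hx : ∀ t, ‖x t‖ ≤ 1) (y : ℕ → ℝ) (t : ℕ) :
    dataBefore α₁ α₂ x y t = [] ∧ Settles α₁ α₂ (dataBefore α₁ α₂ x y t) (x t) := by
  have hs : ∀ t, Settles α₁ α₂ ([] : Dataset n) (x t) := by
    intro t
    refine ⟨?_, (norm_uBar_le _ _).trans ?_⟩
    · rw [Subsingleton.elim (α := EuclideanSpace ℝ (Fin 0)) (qBar [] (x t)) 0, norm_zero]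
      exact h₁
    · nlinarith [norm_augment_sq_le (hx t)]
  have hD : ∀ t, dataBefore α₁ α₂ x y t = [] := by
    intro t
    induction t with
    | zero => rfl
    | succ t ih => rw [dataBefore, ih, if_pos (hs t)]
  exact ⟨hD t, by rw [hD t]; exact hs t⟩

/-- Absorbs the logarithm of the union bound into the one of the final estimate; `ε < 3` is what
permits inserting `ε` in the denominator. -/
theorem log_noise_le {n T : ℕ} {ε δ : ℝ} (hn : 1 ≤ n) (hT : 1 ≤ T) (hε : 0 < ε) (hε3 : ε < 3)
    (hδ : 0 < δ) :
    Real.log (2 * (n + 1 + T) / δ) ≤ 4 * Real.log (3 + n * T / (ε * δ)) := by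
  have hn' : (1 : ℝ) ≤ n := by exact_mod_cast hn
  have hT' : (1 : ℝ) ≤ T := by exact_mod_cast hT
  set z : ℝ := n * T / (ε * δ) with hz
  have hz0 : 0 < z := by positivity
  have h1 : 2 * (n + 1 + T) / δ ≤ 18 * z := by
    rw [hz, ← mul_div_assoc, div_le_div_iff₀ hδ (by positivity)]
    have : (n : ℝ) + 1 + T ≤ 3 * (n * T) := by nlinarith
    nlinarith [mul_pos hε hδ, mul_le_mul_of_nonneg_right this (mul_pos hε hδ).le,
      mul_le_mul_of_nonneg_right hε3.le (by positivity : 0 ≤ (n : ℝ) * T * δ)]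
  have h2 : 18 * z ≤ (3 + z) ^ 4 := by
    have : (3 + z) ^ 4 = 81 + 108 * z + 54 * z ^ 2 + 12 * z ^ 3 + z ^ 4 := by ring
    rw [this]
    have : 0 ≤ z ^ 2 ∧ 0 ≤ z ^ 3 ∧ 0 ≤ z ^ 4 := ⟨by positivity, by positivity, by positivity⟩
    linarith
  have h3 := Real.log_le_log (by positivity) (h1.trans h2)
  rw [Real.log_pow] at h3
  exact_mod_cast h3

/-- A choice of the threshold and of the bound on the number of court cases. -/
theorem exists_parameters {K : ℝ} (hK : 4 ≤ K) : ∃ C : ℝ, 0 < C ∧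
    ∀ (n : ℕ) (ε δ : ℝ) (T : ℕ), 1 ≤ n → 0 < ε → ε < 3 → 0 < δ → δ < 1 → 1 ≤ T →
      ∃ α m : ℝ, 0 < α ∧ α ≤ ε / 4 ∧ α ^ 2 / 2 ≤ 1 ∧ 0 < m ∧
        4 * (n + 1) / (α ^ 2 / 2) * Real.log (8 * (n + 1) / (α ^ 2 / 2)) ≤ m ∧
        α ^ 2 * (2 * (√(n + 1) * (√m * (K * Real.log (3 + n * T / (ε * δ)))))) ≤ ε ^ 2 / 4 ∧
        α ^ 2 * ((3 + K) * Real.log (3 + n * T / (ε * δ))) ≤ ε / 4 ∧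
        m ≤ C * ((n : ℝ) ^ 3 / ε ^ 4) * Real.log (3 + n * T / (ε * δ)) ^ 5 := by
  -- `6144 = 96 · 64` makes the bound on `√(n+1) √m` below exact after squaring, which gives exactly
  -- `ε²/4` in the accuracy condition.
  set c : ℝ := 6144 * K ^ 2 with hc
  have hcK : 24576 * K ≤ c := by nlinarith
  have hc0 : 0 < c := by positivity
  refine ⟨48 * c ^ 3, by positivity, fun n ε δ T hn hε hε3 hδ hδ1 hT => ?_⟩
  have hn' : (1 : ℝ) ≤ n := by exact_mod_cast hn
  have hT' : (1 : ℝ) ≤ T := by exact_mod_cast hT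
  set z : ℝ := n * T / (ε * δ) with hz
  have hz0 : 0 < z := by positivity
  have hnz : n / ε ≤ z := by
    rw [hz, div_le_div_iff₀ hε (by positivity)]
    have : δ ≤ T := by linarith
    nlinarith [mul_le_mul_of_nonneg_left this (by positivity : 0 ≤ (n : ℝ) * ε)]
  set l := Real.log (3 + z) with hl
  have hl1 : 1 ≤ l := by
    rw [hl, Real.le_log_iff_exp_le (by positivity)]
    linarith [Real.exp_one_lt_d9]
  have hlz : l ≤ 3 + z := (Real.log_le_sub_one_of_pos (by positivity)).trans (by linarith)
  set α : ℝ := ε ^ 2 / (n * (c * l ^ 2)) with hα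
  have hα0 : 0 < α := by positivity
  have hα2 : α ^ 2 = ε ^ 4 / (n ^ 2 * (c ^ 2 * l ^ 4)) := by rw [hα]; field_simp
  have hl2 : 1 ≤ l ^ 2 := one_le_pow₀ hl1
  have hcl : c ≤ n * (c * l ^ 2) := by
    nlinarith [mul_le_mul_of_nonneg_left hl2 hc0.le,
      mul_le_mul_of_nonneg_right hn' (by positivity : 0 ≤ c * l ^ 2)]
  have hαε : α ≤ ε / 4 := by
    rw [hα, div_le_div_iff₀ (by positivity) (by norm_num)]
    nlinarith [mul_le_mul_of_nonneg_left hcl hε.le]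
  -- `48 c³ l⁵` is `16 c² l⁴`, from the prefactor, times `3 c l`, which bounds the logarithm.
  set m : ℝ := 48 * c ^ 3 * (n ^ 3 / ε ^ 4) * l ^ 5 with hm
  have hm0 : 0 < m := by positivity
  refine ⟨α, m, hα0, hαε, by nlinarith, hm0, ?_, ?_, ?_, le_rfl⟩
  · have hγ : ∀ r : ℝ, r * (n + 1) / (α ^ 2 / 2) ≤ (4 * r) * (n ^ 3 / ε ^ 4) * (c ^ 2 * l ^ 4) ∨
        r < 0 := by
      intro r
      rcases lt_or_ge r 0 with h | h
      · exact Or.inr h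
      · left
        rw [hα2]
        have e : r * (n + 1) / (ε ^ 4 / (n ^ 2 * (c ^ 2 * l ^ 4)) / 2) =
            2 * r * ((n + 1) * n ^ 2 / ε ^ 4) * (c ^ 2 * l ^ 4) := by field_simp
        rw [e]
        have h2 : ((n : ℝ) + 1) * n ^ 2 / ε ^ 4 ≤ 2 * (n ^ 3 / ε ^ 4) := by
          rw [← mul_div_assoc]
          refine div_le_div_of_nonneg_right ?_ (by positivity)
          nlinarith [sq_nonneg (n : ℝ)]
        calc 2 * r * ((n + 1) * n ^ 2 / ε ^ 4) * (c ^ 2 * l ^ 4)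
            ≤ 2 * r * (2 * (n ^ 3 / ε ^ 4)) * (c ^ 2 * l ^ 4) := by gcongr
          _ = _ := by ring
    have h4 := (hγ 4).resolve_right (by norm_num)
    have h8 := (hγ 8).resolve_right (by norm_num)
    have hlog : Real.log (8 * (n + 1) / (α ^ 2 / 2)) ≤ 3 * c * l := by
      have hnε : (n : ℝ) ^ 3 / ε ^ 4 ≤ (3 + z) ^ 4 := by
        calc (n : ℝ) ^ 3 / ε ^ 4 ≤ n ^ 4 / ε ^ 4 :=
              div_le_div_of_nonneg_right (pow_le_pow_right₀ hn' (by norm_num)) (by positivity)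
          _ = (n / ε) ^ 4 := by rw [div_pow]
          _ ≤ (3 + z) ^ 4 := pow_le_pow_left₀ (by positivity) (by linarith) 4
      have h81 : (4 * 8 : ℝ) ≤ (3 + z) ^ 4 :=
        le_trans (by norm_num) (pow_le_pow_left₀ (by norm_num) (by linarith : 3 ≤ 3 + z) 4)
      have h5 : 8 * (n + 1) / (α ^ 2 / 2) ≤ (3 + z) ^ 12 * c ^ 2 := by
        refine h8.trans ?_
        calc (4 * 8) * (n ^ 3 / ε ^ 4) * (c ^ 2 * l ^ 4)
            ≤ (3 + z) ^ 4 * (3 + z) ^ 4 * (c ^ 2 * (3 + z) ^ 4) := by gcongr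
          _ = _ := by ring
      have h6 := Real.log_le_log (by positivity) h5
      rw [Real.log_mul (by positivity) (by positivity), Real.log_pow, Real.log_pow, ← hl] at h6
      have h7 := Real.log_le_sub_one_of_pos hc0
      push_cast at h6
      nlinarith [mul_le_mul_of_nonneg_left hl1 hc0.le]
    have hlog0 : 0 ≤ 3 * c * l := by positivity
    calc 4 * (n + 1) / (α ^ 2 / 2) * Real.log (8 * (n + 1) / (α ^ 2 / 2))
        ≤ 4 * (n + 1) / (α ^ 2 / 2) * (3 * c * l) :=
          mul_le_mul_of_nonneg_left hlog (by positivity)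
      _ ≤ (4 * 4) * (n ^ 3 / ε ^ 4) * (c ^ 2 * l ^ 4) * (3 * c * l) :=
          mul_le_mul_of_nonneg_right h4 hlog0
      _ = m := by rw [hm]; ring
  · have hR : √(n + 1) * √m ≤ n ^ 2 * c ^ 2 * l ^ 3 / (8 * K * ε ^ 2) := by
      rw [← Real.sqrt_mul (by positivity)]
      refine Real.sqrt_le_iff.2 ⟨by positivity, ?_⟩
      have e : (n ^ 2 * c ^ 2 * l ^ 3 / (8 * K * ε ^ 2)) ^ 2 =
          96 * c ^ 3 * (n ^ 4 / ε ^ 4) * l ^ 6 := by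
        rw [hc]
        field_simp
        ring
      rw [e]
      have hn2 : (n : ℝ) + 1 ≤ 2 * n := by linarith
      have hl6 : l ^ 5 ≤ l ^ 6 := pow_le_pow_right₀ hl1 (by norm_num)
      calc ((n : ℝ) + 1) * m ≤ 2 * n * (48 * c ^ 3 * (n ^ 3 / ε ^ 4) * l ^ 6) := by
            rw [hm]; gcongr
        _ = _ := by ring
    calc α ^ 2 * (2 * (√(n + 1) * (√m * (K * l)))) = α ^ 2 * (2 * (√(n + 1) * √m) * (K * l)) := by
          ring
      _ ≤ α ^ 2 * (2 * (n ^ 2 * c ^ 2 * l ^ 3 / (8 * K * ε ^ 2)) * (K * l)) := by gcongr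
      _ = ε ^ 2 / 4 := by
          rw [hα2]
          field_simp
          norm_num
  · rw [hα2, div_mul_eq_mul_div, div_le_div_iff₀ (by positivity) (by norm_num)]
    have h1 : ε ^ 3 ≤ 27 := by
      calc ε ^ 3 ≤ 3 ^ 3 := pow_le_pow_left₀ hε.le hε3.le 3
        _ = 27 := by norm_num
    have h2 : 108 * (3 + K) ≤ c ^ 2 := by nlinarith
    have h3 : l ≤ l ^ 4 := le_self_pow₀ hl1 (by norm_num)
    have h4 : (1 : ℝ) ≤ n ^ 2 := one_le_pow₀ hn'
    calc ε ^ 4 * ((3 + K) * l) * 4 = ε * (ε ^ 3 * (4 * (3 + K)) * l) := by ring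
      _ ≤ ε * (27 * (4 * (3 + K)) * l ^ 4) := by gcongr
      _ = ε * (1 * ((108 * (3 + K)) * l ^ 4)) := by ring
      _ ≤ ε * (n ^ 2 * (c ^ 2 * l ^ 4)) := by gcongr

end Guarantees

end

end CourtLearning

/-! ### Assembly of the theorem -/

theorem mainTheorem5 (σ : ℝ≥0) :
    ∃ (C : ℝ) (k : ℕ), 0 < C ∧
      ∀ (n : ℕ) (ε δ : ℝ) (T : ℕ), 1 ≤ n → 0 < ε → 0 < δ → δ < 1 → 1 ≤ T →
        ∃ α₁ α₂ : ℝ, 0 < α₁ ∧ 0 < α₂ ∧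
          ∀ (L : CourtLearning.Dataset n → EuclideanSpace ℝ (Fin (n + 1))),
            (∀ D, CourtLearning.IsConstrainedLeastSquares D (L D)) →
          ∀ (β : EuclideanSpace ℝ (Fin (n + 1))), ‖β‖ ≤ 1 →
          ∀ (Ω : Type*) (mΩ : MeasurableSpace Ω) (μ : Measure Ω), IsProbabilityMeasure μ →
          ∀ (ℱ : Filtration ℕ mΩ) (x : ℕ → Ω → EuclideanSpace ℝ (Fin n)) (η : ℕ → Ω → ℝ),
            CourtLearning.IsCaseProcess μ σ ℱ x η →
          ∃ G : Set Ω, MeasurableSet G ∧ ENNReal.ofReal (1 - δ) ≤ μ G ∧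
            ∀ ω ∈ G,
              let xs : ℕ → EuclideanSpace ℝ (Fin n) := fun t => x t ω
              let ys : ℕ → ℝ := fun t => CourtLearning.linearRule β (x t ω) + η t ω
              let D : ℕ → CourtLearning.Dataset n := CourtLearning.dataBefore α₁ α₂ xs ys
              (∀ t, CourtLearning.Settles α₁ α₂ (D t) (xs t) →
                |CourtLearning.linearRule (L (D t)) (xs t) - CourtLearning.linearRule β (xs t)|
                  ≤ ε) ∧
              (∀ t < T, CourtLearning.Settles α₁ α₂ (D t) (xs t) →
                |CourtLearning.linearRule (L (D t)) (xs t) -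
                  CourtLearning.linearRule (L (D t ++ [(xs t, ys t)])) (xs t)| ≤ ε) ∧
              (∀ N : ℕ, (CourtLearning.courtCost α₁ α₂ xs ys N : ℝ) ≤
                C * ((n : ℝ) ^ 3 / ε ^ 4) * Real.log (3 + (n : ℝ) * T / (ε * δ)) ^ k) := by
  -- The `4` comes from `log_noise_le`, the `σ²/2` from the compensator of the exponential
  -- martingale.
  set K : ℝ := 4 + (σ : ℝ) ^ 2 / 2 with hKdef
  obtain ⟨C, hC, hpar⟩ :=
    CourtLearning.exists_parameters (K := K) (by rw [hKdef]; nlinarith [sq_nonneg (σ : ℝ)])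
  refine ⟨C, 5, hC, fun n ε δ T hn hε hδ hδ1 hT => ?_⟩
  rcases le_or_gt 3 ε with hε3 | hε3
  -- For `ε ≥ 3` nothing needs to be learned: all predictions lie in `[-3/2, 3/2]`, and threshold `2
  -- ≥ √2` settles every case.
  · refine ⟨2, 2, by norm_num, by norm_num, ?_⟩
    intro L hL β hβ Ω mΩ μ hμ ℱ x η h
    refine ⟨Set.univ, MeasurableSet.univ, ?_, fun ω _ => ?_⟩
    · rw [measure_univ]
      exact ENNReal.ofReal_le_one.2 (by linarith)
    · intro xs ys D
      have hx : ∀ t, ‖xs t‖ ≤ 1 := fun t => h.case_norm_le t ω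
      have hdiff : ∀ (b b' : EuclideanSpace ℝ (Fin (n + 1))) (t : ℕ), ‖b‖ ≤ 1 → ‖b'‖ ≤ 1 →
          |CourtLearning.linearRule b (xs t) - CourtLearning.linearRule b' (xs t)| ≤ ε := by
        intro b b' t hb hb'
        have h1 := CourtLearning.abs_linearRule_le b (hx t)
        have h2 := CourtLearning.abs_linearRule_le b' (hx t)
        have h3 := abs_sub (CourtLearning.linearRule b (xs t)) (CourtLearning.linearRule b' (xs t))
        linarith
      refine ⟨fun t _ => hdiff _ _ t (hL _).1 hβ, fun t _ _ => hdiff _ _ t (hL _).1 (hL _).1,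
        fun N => ?_⟩
      have hD := (CourtLearning.dataBefore_eq_nil (α₁ := 2) (α₂ := 2) (by norm_num) le_rfl hx ys
        N).1
      have h0 := CourtLearning.length_dataBefore (α₁ := 2) (α₂ := 2) xs ys N
      rw [hD] at h0
      rw [← h0, List.length_nil, Nat.cast_zero]
      have hlog : 0 ≤ Real.log (3 + (n : ℝ) * T / (ε * δ)) :=
        Real.log_nonneg (by linarith [show 0 ≤ (n : ℝ) * T / (ε * δ) by positivity])
      positivity
  · obtain ⟨α, m, hα, hαε, hγ1, hm, hcost, hα1, hα2, hmC⟩ := hpar n ε δ T hn hε hε3 hδ hδ1 hT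
    refine ⟨α, ε / 4, hα, by positivity, ?_⟩
    intro L hL β hβ Ω mΩ μ hμ ℱ x η h
    have hcost' : ∀ ω N, (CourtLearning.courtCost α (ε / 4) (fun s => x s ω)
        (fun s => CourtLearning.linearRule β (x s ω) + η s ω) N : ℝ) ≤ m := fun ω N =>
      (CourtLearning.courtCost_le hα (by positivity) (by positivity) hγ1
        (by rw [min_eq_left hαε]) (fun t => h.case_norm_le t ω) _ N).trans hcost
    obtain ⟨G, hG, hμG, hgood⟩ := CourtLearning.exists_event_noise h
      (fun s ω => CourtLearning.linearRule β (x s ω) + η s ω) T hδ hm hcost'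
    have hlogle := CourtLearning.log_noise_le (n := n) (T := T) hn hT hε hε3 hδ
    set l := Real.log (3 + (n : ℝ) * T / (ε * δ)) with hl
    have hl1 : 1 ≤ l := by
      rw [hl, Real.le_log_iff_exp_le (by positivity)]
      linarith [Real.exp_one_lt_d9, show 0 ≤ (n : ℝ) * T / (ε * δ) by positivity]
    have hH : Real.log (2 * (n + 1 + T) / δ) + (σ : ℝ) ^ 2 / 2 ≤ K * l := by
      rw [hKdef]
      nlinarith [mul_le_mul_of_nonneg_left hl1 (by positivity : 0 ≤ (σ : ℝ) ^ 2 / 2)]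
    have hK0 : 0 < K := by positivity
    refine ⟨G, hG, hμG, fun ω hω => ?_⟩
    intro xs ys D
    obtain ⟨hsum, hnoise⟩ := hgood ω hω
    refine ⟨fun t hs => ?_, fun t ht hs => ?_, fun N => (hcost' ω N).trans hmC⟩
    · refine hs.abs_sub_le (hL _) hβ hα.le le_rfl hε.le
        (by positivity : 0 ≤ √m * (K * l)) hα1 fun j => ?_
      rw [CourtLearning.sum_map_dataBefore]
      refine le_trans (le_of_eq ?_) ((hsum j t).trans
        (mul_le_mul_of_nonneg_left hH (Real.sqrt_nonneg m)))
      simp only [ys, xs, add_sub_cancel_left]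
    · refine hs.abs_sub_append_le (hL _) (hL _) (h.case_norm_le t ω) hα.le le_rfl hε.le ?_
      refine le_trans (mul_le_mul_of_nonneg_left ?_ (sq_nonneg α)) hα2
      have h1 := (CourtLearning.abs_linearRule_le β (h.case_norm_le t ω)).trans
        (mul_le_mul_of_nonneg_right hβ (by norm_num))
      have h2 := abs_add_le (CourtLearning.linearRule β (x t ω)) (η t ω)
      have h3 := (hnoise t ht).trans hH
      have h4 : |ys t| = |CourtLearning.linearRule β (x t ω) + η t ω| := rfl
      linarith
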